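/- **Theorem (Comparison principle for $(HJ^1)$).** Let $\alpha>0$ and let $V,U$ satisfy: - $V:\mathbb R\setminus\{0\}\to\mathbb R$ is even, convex on $(0,\infty)$, $V\in W^{2,1}_{\mathrm{loc}}(0,\infty)$, $V''\in L^1(1,\infty)$, and $x\mapsto x^2V''(x)$ is in $L^1_{\mathrm{loc}}(\mathbb R)$; - $U\in C^1(\mathbb R)$ and $U'$ is Lipschitz continuous. Put $V_\alpha(x)=\alpha V(\alpha x)$, $Q=(0,\infty)\times\mathbb R$ with points $(t,x)$, and $B_\rho=(-\rho,\rho)$. For $\rho>0$, $\phi\in C^2(Q)$ and $u:Q\to\mathbb R$ bounded and measurable let $$H_\rho[\phi,u](t,x)=\Big(\int_{B_\rho}\big(\phi(t,x+z)-\phi(t,x)-\phi_x(t,x)z\big)V_\alpha''(z)\,dz+\int_{\mathbb R\setminus B_\rho}\big(u(t,x+z)-u(t,x)\big)V_\alpha''(z)\,dz+U'(x)\Big)\,|\phi_x(t,x)|.$$ A bounded upper semicontinuous $u:Q\to\mathbb R$ is a *$\rho$-subsolution* of $$u_t=(\mathcal M[u]+U')\,|u_x|,\qquad \mathcal M[u](t,x)=\mathrm{pv}\!\int_{\mathbb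 R}\big(u(t,x+z)-u(t,x)\big)V_\alpha''(z)\,dz,\tag{$HJ^1$}$$ if, whenever $\phi\in C^2(Q)$ and $u-\phi$ has a global maximum on $Q$ at $(\bar t,\bar x)\in Q$, - $\phi_t(\bar t,\bar x)\le H_\rho[\phi,u](\bar t,\bar x)$ if $\phi_x(\bar t,\bar x)\ne0$; - $\phi_t(\bar t,\bar x)\le0$ if $\phi(t,x)=\theta|x-\bar x|^4+g(t)$ on $Q$ for some $\theta\in\mathbb R$ and $g\in C^2((0,\infty))$ (and no condition is imposed otherwise). A bounded lower semicontinuous $v:Q\to\mathbb R$ is a *$\rho$-supersolution* if, whenever $\psi\in C^2(Q)$ and $v-\psi$ has a global minimum on $Q$ at $(\bar t,\bar x)\in Q$, one has $\psi_t(\bar t,\bar x)\ge H_\rho[\psi,v](\bar t,\bar x)$ if $\psi_x(\bar t,\bar x)\neq0$, and $\psi_t(\bar t,\bar x)\ge0$ if $\psi(t,x)=\theta|x-\bar x|^4+g(t)$ on $Q$ with $\theta,g$ as above. A subsolution (supersolution) is a $\rho$-subsolution ($\rho$-supersolution) for some $\rho>0$. They are extended to $t=0$ by the semicontinuous envelopes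 $$u(0,x):=u^*(0,x)=\limsup_{Q\ni(s,y)\to(0,x)}u(s,y),\qquad v(0,x):=v_*(0,x)=\liminf_{Q\ni(s,y)\to(0,x)}v(s,y).$$ Let $u^\circ:\mathbb R\to\mathbb R$ be bounded and uniformly continuous, and let $u$ be a subsolution and $v$ a supersolution of $(HJ^1)$. If $u(0,\cdot)\le u^\circ\le v(0,\cdot)$ on $\mathbb R$, then $u\le v$ on $Q$. -/

import Mathlib

open Set Filter Topology MeasureTheory
open scoped ContDiff NNReal

noncomputable section

/-- `g` is the weak derivative of `f` on the open set `Ω ⊆ ℝ`; both are locally integrable on `Ω`.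
Thus `f ∈ W^{1,1}_loc(Ω)` iff such a `g` exists, and `g` is unique up to null sets. -/
def IsWeakDerivOn (Ω : Set ℝ) (f g : ℝ → ℝ) : Prop :=
  LocallyIntegrableOn f Ω ∧ LocallyIntegrableOn g Ω ∧
    ∀ η : ℝ → ℝ, ContDiff ℝ ∞ η → HasCompactSupport η → tsupport η ⊆ Ω →
      ∫ x in Ω, f x * deriv η x = -∫ x in Ω, g x * η x

/-- `g` is the weak second derivative of `f` on `Ω`, where `f ∈ W^{2,1}_loc(Ω)`. -/
def IsWeakDeriv2On (Ω : Set ℝ) (f g : ℝ → ℝ) : Prop :=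
  ∃ f₁ : ℝ → ℝ, IsWeakDerivOn Ω f f₁ ∧ IsWeakDerivOn Ω f₁ g

/-- The second derivative of `V_α(z) = α V(α z)`, for an even potential `V` on `ℝ ∖ {0}` whose
second derivative on `(0,∞)` is `V₂`; at `z ≠ 0` the second derivative of `V` is `V₂ |z|`. -/
def scaledSecondDeriv (V₂ : ℝ → ℝ) (α z : ℝ) : ℝ := α ^ 3 * V₂ |α * z|

/-- The open space-time domain `Q = (0,∞) × ℝ`, with points `(t, x)`. -/
def Q : Set (ℝ × ℝ) := Ioi 0 ×ˢ univ

/-- Partial derivative in time. -/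
def partialT (φ : ℝ × ℝ → ℝ) (t x : ℝ) : ℝ := deriv (fun s => φ (s, x)) t

/-- Partial derivative in space. -/
def partialX (φ : ℝ × ℝ → ℝ) (t x : ℝ) : ℝ := deriv (fun y => φ (t, y)) x

/-- The nonlocal operator `I_ρ[ψ, w](x)`, with kernel `W = V_α''`: the test function `ψ` is used
inside the ball `(-ρ, ρ)`, and the function `w` outside of it. -/
def nonlocalOp (W : ℝ → ℝ) (ρ : ℝ) (ψ w : ℝ → ℝ) (x : ℝ) : ℝ :=
  (∫ z in Ioo (-ρ) ρ, (ψ (x + z) - ψ x - deriv ψ x * z) * W z) +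
    ∫ z in (Ioo (-ρ) ρ)ᶜ, (w (x + z) - w x) * W z

/-- The Hamiltonian `H_ρ[φ, u](t, x) = (I_ρ[φ(t,·), u(t,·)](x) + U'(x)) |φ_x(t, x)|`. -/
def hamiltonian (W U : ℝ → ℝ) (ρ : ℝ) (φ u : ℝ × ℝ → ℝ) (t x : ℝ) : ℝ :=
  (nonlocalOp W ρ (fun y => φ (t, y)) (fun y => u (t, y)) x + deriv U x) * |partialX φ t x|

/-- On `Q`, `φ(t, x) = θ |x - x₀|⁴ + g(t)` for some `θ ∈ ℝ` and `g ∈ C²((0,∞))`. -/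
def IsQuarticAt (φ : ℝ × ℝ → ℝ) (x₀ : ℝ) : Prop :=
  ∃ (θ : ℝ) (g : ℝ → ℝ), ContDiffOn ℝ 2 g (Ioi 0) ∧
    ∀ t x : ℝ, 0 < t → φ (t, x) = θ * |x - x₀| ^ 4 + g t

/-- `ρ`-subsolution of `u_t = (M[u] + U') |u_x|` in `Q`. There is no condition on test functions
whose spatial derivative vanishes at the maximum and which are not quartic there. -/
def IsRhoSubsolution (W U : ℝ → ℝ) (ρ : ℝ) (u : ℝ × ℝ → ℝ) : Prop :=
  UpperSemicontinuousOn u Q ∧ (∃ C : ℝ, ∀ p ∈ Q, |u p| ≤ C) ∧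
    ∀ φ : ℝ × ℝ → ℝ, ContDiffOn ℝ 2 φ Q → ∀ t x : ℝ, (t, x) ∈ Q →
      IsMaxOn (fun p => u p - φ p) Q (t, x) →
        (partialX φ t x ≠ 0 → partialT φ t x ≤ hamiltonian W U ρ φ u t x) ∧
        (IsQuarticAt φ x → partialT φ t x ≤ 0)

/-- `ρ`-supersolution of `v_t = (M[v] + U') |v_x|` in `Q`. -/
def IsRhoSupersolution (W U : ℝ → ℝ) (ρ : ℝ) (v : ℝ × ℝ → ℝ) : Prop :=
  LowerSemicontinuousOn v Q ∧ (∃ C : ℝ, ∀ p ∈ Q, |v p| ≤ C) ∧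
    ∀ ψ : ℝ × ℝ → ℝ, ContDiffOn ℝ 2 ψ Q → ∀ t x : ℝ, (t, x) ∈ Q →
      IsMinOn (fun p => v p - ψ p) Q (t, x) →
        (partialX ψ t x ≠ 0 → hamiltonian W U ρ ψ v t x ≤ partialT ψ t x) ∧
        (IsQuarticAt ψ x → 0 ≤ partialT ψ t x)

/-- Subsolution: a `ρ`-subsolution for some `ρ > 0`. -/
def IsSubsolution (W U : ℝ → ℝ) (u : ℝ × ℝ → ℝ) : Prop :=
  ∃ ρ : ℝ, 0 < ρ ∧ IsRhoSubsolution W U ρ u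

/-- Supersolution: a `ρ`-supersolution for some `ρ > 0`. -/
def IsSupersolution (W U : ℝ → ℝ) (v : ℝ × ℝ → ℝ) : Prop :=
  ∃ ρ : ℝ, 0 < ρ ∧ IsRhoSupersolution W U ρ v

/-- The initial value `u(0, x) := u^*(0, x)` of a subsolution: the upper semicontinuous envelope of
`u : Q → ℝ` at the boundary point `(0, x)`. -/
def upperInitial (u : ℝ × ℝ → ℝ) (x : ℝ) : ℝ := limsup u (𝓝[Q] ((0 : ℝ), x))

/-- The initial value `v(0, x) := v_*(0, x)` of a supersolution. -/
def lowerInitial (v : ℝ × ℝ → ℝ) (x : ℝ) : ℝ := liminf v (𝓝[Q] ((0 : ℝ), x))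

end

/-! Convexity makes the kernel W = V_α'' nonnegative, hence a symmetric Lévy density; only this is
used of V. Put w = -v, a subsolution for the forcing -U. If u + w were positive somewhere, one would
double the variables.

At a critical point the definition speaks only about test functions quartic in space. So x and y are
tied to auxiliary points a and b by k(x-a)⁴ and k(y-b)⁴, and only a and b are tied to each other, by
θ(a-b)² with θ = n e^{λt}. With the other variables frozen, each test function is an admissible
quartic, and a vanishing gradient does no harm. Optimality in a and b gives the gradients P₂ =
2θ(a-b) and P₁ = P₂ + O(δ).

`IsRhoSubsolution.deriv_le` shrinks the ball on which the test function is used to radius r; letting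
r → 0 removes all terms containing k. Translating (x, a) and (y, b) together changes only the
logarithmic penalty, so the sum of the two nonlocal terms is at most O(δ) plus a tail. Translating
one pair bounds each term from above, which is needed because |P₁| and |P₂| differ. The Lipschitz
drift costs 2Lθ(a-b)², absorbed by the time derivative of e^{λt} with λ = 2L
(`doubling_max_inequality`, `doubling_error_le`). The penalty γt then yields a contradiction. -/

/-! ### From the convex potential to a Lévy density -/

/-- A locally integrable function on `(0, ∞)` which is nonnegative as a distribution is
nonnegative almost everywhere. -/
theorem ae_nonneg_of_forall_integral_contDiff {g : ℝ → ℝ} (hg : LocallyIntegrableOn g (Ioi 0))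
    (h : ∀ η : ℝ → ℝ, ContDiff ℝ ∞ η → HasCompactSupport η → tsupport η ⊆ Ioi 0 → (∀ x, 0 ≤ η x) →
      0 ≤ ∫ x in Ioi 0, g x * η x) :
    ∀ᵐ x : ℝ, 0 < x → 0 ≤ g x := by
  have key : ∀ m : ℕ, ∀ᵐ x : ℝ, x ∈ Ioo (1 / ((m : ℝ) + 1)) m → 0 ≤ g x := by
    intro m
    set J : Set ℝ := Icc (1 / ((m : ℝ) + 1)) m with hJ
    have hpos : (0 : ℝ) < 1 / ((m : ℝ) + 1) := by positivity
    have hJ0 : J ⊆ Ioi 0 := fun x hx => lt_of_lt_of_le hpos hx.1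
    have hint : Integrable (J.indicator g) :=
      (integrable_indicator_iff measurableSet_Icc).2 (hg.integrableOn_compact_subset hJ0 isCompact_Icc)
    let φ : ℕ → ContDiffBump (0 : ℝ) := fun i =>
      ⟨1 / ((i : ℝ) + 1) / 2, 1 / ((i : ℝ) + 1), by positivity, half_lt_self (by positivity)⟩
    have hφ : Tendsto (fun i => (φ i).rOut) atTop (𝓝 0) := tendsto_one_div_add_atTop_nhds_zero_nat
    have hK : ∀ᶠ i in atTop, (φ i).rOut ≤ 2 * (φ i).rIn :=
      Eventually.of_forall fun i => by simp only [φ]; linarith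
    filter_upwards [ContDiffBump.ae_convolution_tendsto_right_of_locallyIntegrable (μ := volume)
      hφ hK hint.locallyIntegrable] with x hx hxJ
    have hxJ' : x ∈ J := Ioo_subset_Icc_self hxJ
    rw [indicator_of_mem hxJ'] at hx
    -- Once its radius is below the distance from x to the ends of `J`, the bump centred at x is an
    -- admissible test function, so the mollification of `g` at x is nonnegative.
    have hd : ∀ᶠ i in atTop, (φ i).rOut < min (x - 1 / ((m : ℝ) + 1)) (m - x) :=
      hφ.eventually_lt_const (lt_min (by linarith [hxJ.1]) (by linarith [hxJ.2]))
    refine ge_of_tendsto hx (hd.mono fun i hi => ?_)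
    rw [lt_min_iff] at hi
    set η : ℝ → ℝ := fun y => (φ i).normed volume (x - y) with hη
    have hsub : tsupport η ⊆ J := by
      apply closure_minimal _ isClosed_Icc
      intro y hy
      have : x - y ∈ Function.support ((φ i).normed volume) := hy
      rw [(φ i).support_normed_eq, Metric.mem_ball, dist_zero_right, Real.norm_eq_abs, abs_lt] at this
      exact ⟨by linarith [this.2], by linarith [this.1]⟩
    have hη0 := h η ((φ i).contDiff_normed.comp (contDiff_const.sub contDiff_id))
      (HasCompactSupport.of_support_subset_isCompact isCompact_Icc ((subset_tsupport η).trans hsub))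
      (hsub.trans hJ0) (fun y => (φ i).nonneg_normed _)
    have : (MeasureTheory.convolution ((φ i).normed volume) (J.indicator g)
        (ContinuousLinearMap.lsmul ℝ ℝ) volume) x = ∫ y in Ioi 0, g y * η y := by
      rw [MeasureTheory.convolution_eq_swap, ← integral_indicator measurableSet_Ioi]
      congr 1
      ext y
      by_cases hy : y ∈ J
      · rw [indicator_of_mem hy, indicator_of_mem (hJ0 hy)]
        simp [hη, mul_comm]
      · have h0 : η y = 0 := image_eq_zero_of_notMem_tsupport fun h' => hy (hsub h')
        rw [indicator_of_notMem hy]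
        simp [indicator, h0]
    rw [this]
    exact hη0
  filter_upwards [ae_all_iff.2 key] with x hx h0
  obtain ⟨m, hm⟩ := exists_nat_gt (max x (1 / x))
  rw [max_lt_iff] at hm
  refine hx m ⟨?_, hm.1⟩
  rw [div_lt_iff₀ (by positivity)]
  have := hm.2
  rw [div_lt_iff₀ h0] at this
  nlinarith

/-- The second distributional derivative of a convex function is nonnegative. -/
theorem ConvexOn.integral_mul_deriv_deriv_nonneg {V : ℝ → ℝ} (hV : ConvexOn ℝ (Ioi 0) V)
    {η : ℝ → ℝ} (hη : ContDiff ℝ ∞ η) (hc : HasCompactSupport η) (hs : tsupport η ⊆ Ioi 0)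
    (h0 : ∀ x, 0 ≤ η x) : 0 ≤ ∫ x in Ioi 0, V x * deriv (deriv η) x := by
  obtain ⟨a, ha, b, hab⟩ : ∃ a > 0, ∃ b, tsupport η ⊆ Icc a b := by
    rcases (tsupport η).eq_empty_or_nonempty with he | hne
    · exact ⟨1, one_pos, 0, by simp [he]⟩
    · obtain ⟨a, haS, ha⟩ := hc.isCompact.exists_isLeast hne
      obtain ⟨b, hbS, hb⟩ := hc.isCompact.exists_isGreatest hne
      exact ⟨a, hs haS, b, fun x hx => ⟨ha hx, hb hx⟩⟩
  -- The margins around `Icc a b` keep x ± h inside `J` for |h| < a/2, so truncating `V` to `J`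
  -- makes it integrable without affecting small shifts.
  set J : Set ℝ := Icc (a / 2) (b + a) with hJ
  have hJ0 : J ⊆ Ioi 0 := fun x hx => lt_of_lt_of_le (half_pos ha) hx.1
  have hcont : ContinuousOn V (Ioi 0) := hV.continuousOn isOpen_Ioi
  set V₁ : ℝ → ℝ := J.indicator V with hV₁
  have hint : Integrable V₁ := (integrable_indicator_iff measurableSet_Icc).2
    ((hcont.mono hJ0).integrableOn_compact isCompact_Icc)
  have hintn : Integrable fun x => V₁ (-x) := hint.comp_neg
  have hη1 : ContDiff ℝ ∞ (deriv η) := contDiff_infty_iff_deriv.1 hη |>.2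
  have hη2 : ContDiff ℝ ∞ (deriv (deriv η)) := contDiff_infty_iff_deriv.1 hη1 |>.2
  let T : (ℝ → ℝ) → ℝ → ℝ := fun f h => ∫ x, V₁ x * f (h + x)
  have hT : ∀ f : ℝ → ℝ, T f = MeasureTheory.convolution (fun x => V₁ (-x)) f
      (ContinuousLinearMap.lsmul ℝ ℝ) volume := by
    intro f
    ext h
    rw [MeasureTheory.convolution]
    simp only [T]
    rw [← integral_neg_eq_self]
    simp [sub_eq_add_neg]
  have hTd : ∀ f : ℝ → ℝ, ContDiff ℝ ∞ f → HasCompactSupport f → ∀ h,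
      HasDerivAt (T f) (T (deriv f) h) h := by
    intro f hf hfc h
    rw [hT, hT]
    exact hfc.hasDerivAt_convolution_right _ hintn.locallyIntegrable (hf.of_le (by simp)) h
  have hF := hTd η hη hc
  have hF1 := hTd _ hη1 hc.deriv
  -- After translation, G(h) = ∫ (V(x-h) + V(x+h)) η(x) dx for small h. Midpoint convexity puts a
  -- local minimum at 0, and G''(0) = 2 ∫ V η''.
  set G : ℝ → ℝ := fun h => T η h + T η (-h) with hG
  have hGd : ∀ h, HasDerivAt G (T (deriv η) h - T (deriv η) (-h)) h := by
    intro h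
    have := (hF h).add ((hF (-h)).comp h (hasDerivAt_neg h))
    convert! this using 1
    ring
  have hGd1 : deriv G = fun h => T (deriv η) h - T (deriv η) (-h) := funext fun h => (hGd h).deriv
  have hGd2 : deriv (deriv G) 0 = 2 * T (deriv (deriv η)) 0 := by
    rw [hGd1]
    have := (hF1 0).sub ((hF1 (-0)).comp 0 (hasDerivAt_neg (0 : ℝ)))
    convert! this.deriv using 1
    simp
    ring
  have hmem : ∀ x, η x ≠ 0 → x ∈ Icc a b := fun x hx => hab (subset_tsupport η hx)
  have hshift : ∀ h, T η h = ∫ x, V₁ (x - h) * η x := by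
    intro h
    simp only [T]
    rw [← integral_sub_right_eq_self (fun x => V₁ x * η (h + x)) h]
    simp
  obtain ⟨M, hM⟩ := hη.continuous.bounded_above_of_compact_support hc
  have hI : ∀ h, Integrable fun x => V₁ (x - h) * η x := fun h =>
    (hint.comp_sub_right h).mul_bdd hη.continuous.aestronglyMeasurable (Eventually.of_forall hM)
  have hmin : IsLocalMin G 0 := by
    have : Ioo (-(a / 2)) (a / 2) ∈ 𝓝 (0 : ℝ) := Ioo_mem_nhds (by linarith) (by linarith)
    filter_upwards [this] with h hh
    simp only [hG, hshift, neg_zero]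
    rw [← integral_add (hI _) (hI _), ← integral_add (hI _) (hI _)]
    refine integral_mono ((hI _).add (hI _)) ((hI _).add (hI _)) fun x => ?_
    by_cases hx : η x = 0
    · simp [hx]
    · have hxab := hmem x hx
      have h1 : x - h ∈ J := ⟨by linarith [hxab.1, hh.2], by linarith [hxab.2, hh.1]⟩
      have h2 : x - -h ∈ J := ⟨by linarith [hxab.1, hh.1], by linarith [hxab.2, hh.2]⟩
      have h3 : x - 0 ∈ J := ⟨by linarith [hxab.1], by linarith [hxab.2]⟩
      simp only [hV₁, indicator_of_mem h1, indicator_of_mem h2, indicator_of_mem h3]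
      have := hV.2 (hJ0 h1) (hJ0 h2) (show (0 : ℝ) ≤ 1 / 2 by norm_num)
        (show (0 : ℝ) ≤ 1 / 2 by norm_num) (by norm_num)
      simp only [smul_eq_mul] at this
      rw [show 1 / 2 * (x - h) + 1 / 2 * (x - -h) = x - 0 by ring] at this
      nlinarith [h0 x]
  have hT0 : T (deriv (deriv η)) 0 = ∫ x in Ioi 0, V x * deriv (deriv η) x := by
    simp only [T]
    rw [← integral_indicator measurableSet_Ioi]
    congr 1
    ext x
    by_cases hx : x ∈ J
    · simp [hV₁, indicator_of_mem hx, indicator_of_mem (hJ0 hx)]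
    · have : deriv (deriv η) x = 0 := by
        by_contra hne
        have h1 := hab (tsupport_deriv_subset (tsupport_deriv_subset (subset_tsupport _ hne)))
        exact hx ⟨by linarith [h1.1], by linarith [h1.2]⟩
      simp [indicator, this]
  rw [← hT0]
  by_contra hneg
  push Not at hneg
  -- If G''(0) < 0, then 0 is also a local maximum, so `G` is constant near 0 and G''(0) = 0.
  have hd0 : deriv G 0 = 0 := hmin.deriv_eq_zero
  have hmax : IsLocalMax G 0 := isLocalMax_of_deriv_deriv_neg (by rw [hGd2]; linarith) hd0
    (hGd 0).continuousAt
  have hc0 : G =ᶠ[𝓝 0] fun _ => G 0 := by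
    filter_upwards [hmin, hmax] with h h1 h2 using le_antisymm h2 h1
  have : deriv (deriv G) 0 = 0 := by
    rw [hc0.deriv.deriv_eq]
    simp
  linarith

/-- `W` is the density of a symmetric Lévy measure. -/
structure IsLevyDensity (W : ℝ → ℝ) : Prop where
  nonneg : ∀ᵐ z : ℝ, 0 ≤ W z
  even : ∀ z, W (-z) = W z
  integrable : Integrable fun z : ℝ => min 1 (z ^ 2) * W z

theorem isLevyDensity_scaledSecondDeriv {V V₂ : ℝ → ℝ} {α : ℝ} (hα : 0 < α)
    (hV_convex : ConvexOn ℝ (Ioi 0) V) (hV_sobolev : IsWeakDeriv2On (Ioi 0) V V₂)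
    (hV_tail : IntegrableOn V₂ (Ioi 1))
    (hV_sing : LocallyIntegrable (fun x : ℝ => x ^ 2 * V₂ |x|)) :
    IsLevyDensity (scaledSecondDeriv V₂ α) := by
  obtain ⟨f₁, ⟨-, -, h1⟩, ⟨-, hV₂, h2⟩⟩ := hV_sobolev
  have hpos : ∀ᵐ x : ℝ, 0 < x → 0 ≤ V₂ x := by
    refine ae_nonneg_of_forall_integral_contDiff hV₂ fun η hη hc hs h0 => ?_
    have hη1 : ContDiff ℝ ∞ (deriv η) := contDiff_infty_iff_deriv.1 hη |>.2
    have := hV_convex.integral_mul_deriv_deriv_nonneg hη hc hs h0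
    rwa [h1 _ hη1 hc.deriv (tsupport_deriv_subset.trans hs), h2 _ hη hc hs, neg_neg] at this
  have hscale : ∀ {p : ℝ → Prop}, (∀ᵐ x : ℝ, p x) → ∀ c : ℝ, c ≠ 0 → ∀ᵐ x : ℝ, p (c * x) :=
    fun hp c hc => (Measure.quasiMeasurePreserving_smul (volume : Measure ℝ) hc).ae hp
  refine ⟨?_, fun z => by simp [scaledSecondDeriv], ?_⟩
  · filter_upwards [hscale hpos α hα.ne', hscale hpos (-α) (neg_ne_zero.2 hα.ne'),
      Measure.ae_ne volume (0 : ℝ)] with z hz1 hz2 hz0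
    refine mul_nonneg (by positivity) ?_
    rcases lt_or_gt_of_ne hz0 with h | h
    · rw [abs_of_neg (mul_neg_of_pos_of_neg hα h), ← neg_mul]
      exact hz2 (by nlinarith)
    · rw [abs_of_pos (mul_pos hα h)]
      exact hz1 (mul_pos hα h)
  · have hf : Integrable fun x : ℝ => min 1 (x ^ 2) * V₂ |x| := by
      have hmid : IntegrableOn (fun x : ℝ => min 1 (x ^ 2) * V₂ |x|) (Icc (-1) 1) := by
        refine (hV_sing.integrableOn_isCompact isCompact_Icc).congr_fun (fun x hx => ?_)
          measurableSet_Icc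
        have : x ^ 2 ≤ 1 := by nlinarith [hx.1, hx.2]
        simp [min_eq_right this]
      have hright : IntegrableOn (fun x : ℝ => min 1 (x ^ 2) * V₂ |x|) (Ioi 1) := by
        refine hV_tail.congr_fun (fun x hx => ?_) measurableSet_Ioi
        have hx' : (1 : ℝ) < x := hx
        have : 1 ≤ x ^ 2 := by nlinarith
        simp [min_eq_left this, abs_of_pos (one_pos.trans hx')]
      have hleft : IntegrableOn (fun x : ℝ => min 1 (x ^ 2) * V₂ |x|) (Iio (-1)) := by
        have := hright.comp_neg
        simpa using this
      rw [← integrableOn_univ]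
      refine ((hmid.union hright).union hleft).mono_set fun x _ => ?_
      simp only [mem_union, mem_Icc, mem_Ioi, mem_Iio]
      by_contra! h
      linarith [h.1.1 h.2, h.1.2]
    -- Rescaling turns the weight into min(1, (αz)²); its ratio to the required min(1, z²) is
    -- bounded above and below by constants, and `hbdd` supplies the bound needed.
    have hf' := hf.comp_mul_left' hα.ne'
    have hbdd : ∀ z : ℝ, ‖α ^ 3 * (min 1 (z ^ 2) / min 1 ((α * z) ^ 2))‖ ≤ α ^ 3 * max 1 (1 / α ^ 2) := by
      intro z
      rw [Real.norm_of_nonneg (by positivity)]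
      gcongr
      refine div_le_of_le_mul₀ (by positivity) (by positivity) ?_
      rcases min_cases 1 ((α * z) ^ 2) with ⟨h, -⟩ | ⟨h, -⟩ <;> rw [h]
      · nlinarith [min_le_left 1 (z ^ 2), le_max_left 1 (1 / α ^ 2)]
      · calc min 1 (z ^ 2) ≤ z ^ 2 := min_le_right _ _
          _ = 1 / α ^ 2 * (α * z) ^ 2 := by field_simp
          _ ≤ _ := by gcongr; exact le_max_right _ _
    refine (hf'.bdd_mul (Measurable.aestronglyMeasurable (by fun_prop))
      (Eventually.of_forall hbdd)).congr (Eventually.of_forall fun z => ?_)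
    rcases eq_or_ne z 0 with rfl | hz
    · simp
    · have : min 1 ((α * z) ^ 2) ≠ 0 := (lt_min one_pos (by positivity)).ne'
      simp only [scaledSecondDeriv]
      field_simp

/-! ### Truncated integrals against a Lévy density -/

namespace IsLevyDensity

variable {W : ℝ → ℝ}

theorem aestronglyMeasurable (hW : IsLevyDensity W) : AEStronglyMeasurable W := by
  have h : AEStronglyMeasurable fun z : ℝ => (min 1 (z ^ 2))⁻¹ * (min 1 (z ^ 2) * W z) :=
    (Measurable.aestronglyMeasurable (by fun_prop)).mul hW.integrable.aestronglyMeasurable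
  refine h.congr ?_
  filter_upwards [Measure.ae_ne volume (0 : ℝ)] with z hz
  have : min 1 (z ^ 2) ≠ 0 := (lt_min one_pos (by positivity)).ne'
  field_simp

theorem integrableOn_sq (hW : IsLevyDensity W) (R : ℝ) :
    IntegrableOn (fun z => z ^ 2 * W z) (Ioo (-R) R) := by
  refine Integrable.mono' ((hW.integrable.norm.const_mul (max 1 (R ^ 2))).restrict)
    (((continuous_pow 2).aestronglyMeasurable.mul hW.aestronglyMeasurable).restrict) ?_
  refine (ae_restrict_mem measurableSet_Ioo).mono fun z hz => ?_
  have hz2 : z ^ 2 ≤ R ^ 2 := by nlinarith [hz.1, hz.2]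
  rw [norm_mul, norm_mul, ← mul_assoc]
  gcongr
  rw [Real.norm_of_nonneg (by positivity), Real.norm_of_nonneg (by positivity)]
  rcases min_cases 1 (z ^ 2) with ⟨h, -⟩ | ⟨h, -⟩ <;> rw [h]
  · rw [mul_one]; exact hz2.trans (le_max_right _ _)
  · exact le_mul_of_one_le_left (by positivity) (le_max_left _ _)

theorem integrableOn_compl (hW : IsLevyDensity W) {r : ℝ} (hr : 0 < r) :
    IntegrableOn W (Ioo (-r) r)ᶜ := by
  refine Integrable.mono' ((hW.integrable.norm.const_mul (min 1 (r ^ 2))⁻¹).restrict)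
    hW.aestronglyMeasurable.restrict ?_
  refine (ae_restrict_mem measurableSet_Ioo.compl).mono fun z hz => ?_
  have hz2 : r ^ 2 ≤ z ^ 2 := by
    rw [← sq_abs z]
    rw [mem_compl_iff, mem_Ioo, ← abs_lt, not_lt] at hz
    gcongr
  have h1 : 0 < min 1 (r ^ 2) := lt_min one_pos (by positivity)
  rw [norm_mul, Real.norm_of_nonneg (show 0 ≤ min 1 (z ^ 2) by positivity), inv_mul_eq_div,
    le_div_iff₀ h1, mul_comm]
  gcongr

theorem integrableOn_compl_mul (hW : IsLevyDensity W) {r : ℝ} (hr : 0 < r) {F : ℝ → ℝ} {K : ℝ}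
    (hF : Measurable F) (hK : ∀ z, |F z| ≤ K) :
    IntegrableOn (fun z => F z * W z) (Ioo (-r) r)ᶜ :=
  Integrable.bdd_mul (hW.integrableOn_compl hr) hF.aestronglyMeasurable (Eventually.of_forall hK)

theorem tendsto_sq_integral (hW : IsLevyDensity W) :
    Tendsto (fun r => ∫ z in Ioo (-r) r, z ^ 2 * W z) (𝓝[>] 0) (𝓝 0) := by
  have h1 := hW.integrableOn_sq 1
  rw [IntegrableOn] at h1
  have hlim := h1.tendsto_setIntegral_nhds_zero (s := fun r : ℝ => Ioo (-r) r) (l := 𝓝[>] 0) (by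
    refine tendsto_of_tendsto_of_tendsto_of_le_of_le tendsto_const_nhds
      (h := fun r : ℝ => ENNReal.ofReal (r - -r)) ?_ (fun _ => zero_le) (fun r => ?_)
    · have : Tendsto (fun r : ℝ => r - -r) (𝓝[>] 0) (𝓝 0) := by
        have : Tendsto (fun r : ℝ => r - -r) (𝓝 0) (𝓝 (0 - -0)) := by
          exact Continuous.tendsto (by fun_prop) _
        simpa using this.mono_left nhdsWithin_le_nhds
      simpa using ENNReal.tendsto_ofReal this
    · exact (Measure.restrict_apply_le _ _).trans (Real.volume_Ioo).le)
  refine hlim.congr' ?_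
  filter_upwards [Ioo_mem_nhdsGT (show (0 : ℝ) < 1 by norm_num)] with r hr
  rw [Measure.restrict_restrict measurableSet_Ioo,
    inter_eq_left.2 (Ioo_subset_Ioo (by linarith [hr.2]) hr.2.le)]

theorem tendsto_tail (hW : IsLevyDensity W) :
    Tendsto (fun R => ∫ z in (Ioo (-R) R)ᶜ, W z) atTop (𝓝 0) := by
  have h1 : Integrable ((Ioo (-1 : ℝ) 1)ᶜ.indicator W) :=
    (integrable_indicator_iff measurableSet_Ioo.compl).2 (hW.integrableOn_compl one_pos)
  have hlim := tendsto_integral_filter_of_dominated_convergence (μ := volume) (l := atTop)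
    (F := fun (R : ℝ) z => (Ioo (-R) R)ᶜ.indicator ((Ioo (-1 : ℝ) 1)ᶜ.indicator W) z) (f := 0)
    (fun z => ‖(Ioo (-1 : ℝ) 1)ᶜ.indicator W z‖)
    (Eventually.of_forall fun R => h1.aestronglyMeasurable.indicator measurableSet_Ioo.compl)
    (Eventually.of_forall fun R => Eventually.of_forall fun z => norm_indicator_le_norm_self _ _)
    h1.norm (Eventually.of_forall fun z => by
      refine tendsto_const_nhds.congr' ?_
      filter_upwards [eventually_gt_atTop |z|] with R hR
      rw [indicator_of_notMem]
      · rfl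
      · simpa [← abs_lt] using hR)
  simp only [Pi.zero_apply, integral_zero] at hlim
  refine hlim.congr' ?_
  filter_upwards [eventually_ge_atTop 1] with R hR
  have hsub : (Ioo (-R) R)ᶜ ⊆ (Ioo (-1 : ℝ) 1)ᶜ :=
    compl_subset_compl.2 (Ioo_subset_Ioo (by linarith) hR)
  rw [indicator_indicator, inter_eq_left.2 hsub, integral_indicator measurableSet_Ioo.compl]

theorem sq_integral_nonneg (hW : IsLevyDensity W) (s : Set ℝ) :
    0 ≤ ∫ z in s, z ^ 2 * W z :=
  integral_nonneg_of_ae (ae_restrict_of_ae (hW.nonneg.mono fun z hz => by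
    simp only [Pi.zero_apply]; positivity))

theorem tail_nonneg (hW : IsLevyDensity W) (s : Set ℝ) : 0 ≤ ∫ z in s, W z :=
  integral_nonneg_of_ae (ae_restrict_of_ae hW.nonneg)

/-- The first moment vanishes on symmetric annuli. -/
theorem integral_annulus_id (hW : IsLevyDensity W) (r R : ℝ) :
    ∫ z in Ioo (-R) R \ Ioo (-r) r, z * W z = 0 := by
  have hS : MeasurableSet (Ioo (-R) R \ Ioo (-r) r) := measurableSet_Ioo.diff measurableSet_Ioo
  rw [← integral_indicator hS]
  set f := (Ioo (-R) R \ Ioo (-r) r).indicator fun z => z * W z with hf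
  have hodd : ∀ z, f (-z) = -f z := by
    intro z
    have hmem : -z ∈ Ioo (-R) R \ Ioo (-r) r ↔ z ∈ Ioo (-R) R \ Ioo (-r) r := by
      simp only [Set.mem_sdiff, mem_Ioo, neg_lt_neg_iff, neg_lt]
      tauto
    by_cases hz : z ∈ Ioo (-R) R \ Ioo (-r) r
    · rw [hf, indicator_of_mem hz, indicator_of_mem (hmem.2 hz), hW.even]; ring
    · rw [hf, indicator_of_notMem hz, indicator_of_notMem (fun h => hz (hmem.1 h)), neg_zero]
  have h1 : ∫ z, f (-z) = ∫ z, f z := integral_neg_eq_self f volume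
  simp only [hodd, integral_neg] at h1
  linarith

theorem integrableOn_annulus_id (hW : IsLevyDensity W) {r R : ℝ} (hr : 0 < r) :
    IntegrableOn (fun z => z * W z) (Ioo (-R) R \ Ioo (-r) r) := by
  have hS : MeasurableSet (Ioo (-R) R \ Ioo (-r) r) := measurableSet_Ioo.diff measurableSet_Ioo
  have h := (hW.integrableOn_compl hr).mono_set (s := Ioo (-R) R \ Ioo (-r) r) (fun z hz => hz.2)
  refine Integrable.bdd_mul (c := |R|) h measurable_id.aestronglyMeasurable ?_
  refine (ae_restrict_mem hS).mono fun z hz => ?_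
  exact (abs_lt.2 hz.1).le.trans (le_abs_self R)

theorem compl_Ioo_eq_union {r R : ℝ} (hrR : r ≤ R) :
    (Ioo (-r) r)ᶜ = (Ioo (-R) R \ Ioo (-r) r) ∪ (Ioo (-R) R)ᶜ := by
  have : Ioo (-r) r ⊆ Ioo (-R) R := Ioo_subset_Ioo (by linarith) hrR
  ext z
  simp only [mem_compl_iff, mem_union, Set.mem_sdiff]
  have := @this z
  tauto

theorem disjoint_annulus (r R : ℝ) :
    Disjoint (Ioo (-R) R \ Ioo (-r) r) (Ioo (-R) R)ᶜ :=
  disjoint_left.2 fun _ h1 h2 => h2 h1.1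

/-- Upper bound for a truncated Lévy operator on an increment `F` with a quadratic majorant. -/
theorem integral_compl_mul_le (hW : IsLevyDensity W) {r R : ℝ} (hr : 0 < r) (hrR : r ≤ R)
    {F : ℝ → ℝ} {K c A M : ℝ} (hF : Measurable F) (hK : ∀ z, |F z| ≤ K) (hA : 0 ≤ A)
    (hquad : ∀ z, F z ≤ c * z + A * z ^ 2) (hM : ∀ z, F z ≤ M) :
    ∫ z in (Ioo (-r) r)ᶜ, F z * W z ≤
      A * (∫ z in Ioo (-R) R, z ^ 2 * W z) + M * ∫ z in (Ioo (-R) R)ᶜ, W z := by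
  have hint := hW.integrableOn_compl_mul hr hF hK
  have hR : 0 < R := hr.trans_le hrR
  rw [compl_Ioo_eq_union hrR] at hint ⊢
  rw [setIntegral_union (disjoint_annulus r R) measurableSet_Ioo.compl hint.left_of_union
    hint.right_of_union]
  have hsq := (hW.integrableOn_sq R).mono_set (s := Ioo (-R) R \ Ioo (-r) r) sdiff_subset
  have hid := hW.integrableOn_annulus_id (R := R) hr
  refine add_le_add ?_ ?_
  -- By symmetry the linear part of the majorant integrates to zero on the annulus, so the bound
  -- depends neither on the slope `c` nor on `r`.
  · calc ∫ z in Ioo (-R) R \ Ioo (-r) r, F z * W z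
        ≤ ∫ z in Ioo (-R) R \ Ioo (-r) r, (c * (z * W z) + A * (z ^ 2 * W z)) := by
          refine integral_mono_ae hint.left_of_union ((hid.const_mul c).add (hsq.const_mul A))
            (ae_restrict_of_ae (hW.nonneg.mono fun z hz => ?_))
          have := mul_le_mul_of_nonneg_right (hquad z) hz
          simp only
          linarith
      _ = A * ∫ z in Ioo (-R) R \ Ioo (-r) r, z ^ 2 * W z := by
          rw [integral_add (hid.const_mul c) (hsq.const_mul A), integral_const_mul,
            integral_const_mul, hW.integral_annulus_id, mul_zero, zero_add]
      _ ≤ _ := by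
          refine mul_le_mul_of_nonneg_left (setIntegral_mono_set (hW.integrableOn_sq R)
            (ae_restrict_of_ae (hW.nonneg.mono fun z hz => ?_)) sdiff_subset.eventuallyLE) hA
          simp only [Pi.zero_apply]
          positivity
  · rw [← integral_const_mul]
    exact integral_mono_ae hint.right_of_union ((hW.integrableOn_compl hR).const_mul M)
      (ae_restrict_of_ae (hW.nonneg.mono fun z hz => mul_le_mul_of_nonneg_right (hM z) hz))

end IsLevyDensity

/-! ### Viscosity inequality with a smaller inner ball -/

/-- A bounded upper semicontinuous function on a set is the limit, from above, of smooth
functions. -/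
theorem UpperSemicontinuousOn.exists_contDiff_tendsto {E : Type*} [NormedAddCommGroup E]
    [NormedSpace ℝ E] [FiniteDimensional ℝ E] {s : Set E} {u : E → ℝ} {C : ℝ}
    (hu : UpperSemicontinuousOn u s) (hs : s.Nonempty) (hC : ∀ p ∈ s, |u p| ≤ C) :
    ∃ h : ℕ → E → ℝ, (∀ n, ContDiff ℝ ∞ (h n)) ∧ (∀ n, ∀ p ∈ s, u p ≤ h n p) ∧
      (∀ n, ∀ p ∈ s, |h n p| ≤ C + 2) ∧ ∀ p ∈ s, Tendsto (fun n => h n p) atTop (𝓝 (u p)) := by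
  have : Nonempty s := hs.to_subtype
  -- The sup-convolution with n·dist is n-Lipschitz and lies above `u`; it is then smoothed within
  -- 1/(n+1) and raised by 1/(n+1) to stay above.
  let g : ℕ → E → ℝ := fun n p => ⨆ q : s, (u q - n * dist p q)
  have hbdd : ∀ (n : ℕ) (p : E), BddAbove (range fun q : s => u q - n * dist p q) := by
    rintro n p
    refine ⟨C, ?_⟩
    rintro _ ⟨q, rfl⟩
    have := (abs_le.1 (hC q q.2)).2
    have : (0 : ℝ) ≤ n * dist p q := by positivity
    simp only
    linarith
  have hlip : ∀ n : ℕ, LipschitzWith n (g n) := by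
    intro n
    refine LipschitzWith.of_le_add_mul _ fun p p' => ciSup_le fun q => ?_
    have h1 : u q - n * dist p' q ≤ g n p' := le_ciSup (hbdd n p') q
    have h2 : (n : ℝ) * dist p' q ≤ n * (dist p p' + dist p q) := by
      gcongr
      rw [dist_comm p p']
      exact dist_triangle _ _ _
    simp only [NNReal.coe_natCast]
    linarith
  have hle : ∀ n, ∀ p ∈ s, u p ≤ g n p := fun n p hp => by
    simpa using le_ciSup (hbdd n p) ⟨p, hp⟩
  have hgC : ∀ n p, g n p ≤ C := fun n p => ciSup_le fun q => by
    have := (abs_le.1 (hC q q.2)).2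
    have : (0 : ℝ) ≤ n * dist p q := by positivity
    linarith
  choose h hsm hh using fun n : ℕ => (hlip n).uniformContinuous.exists_contDiff_dist_le
    (show (0 : ℝ) < 1 / ((n : ℝ) + 1) by positivity)
  have hh' : ∀ n p, |h n p - g n p| < 1 / ((n : ℝ) + 1) := fun n p => hh n p
  have h1 : ∀ n : ℕ, 1 / ((n : ℝ) + 1) ≤ 1 := fun n => by
    rw [div_le_one (by positivity)]
    linarith [n.cast_nonneg (α := ℝ)]
  refine ⟨fun n p => h n p + 1 / ((n : ℝ) + 1), fun n => (hsm n).add contDiff_const,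
    fun n p hp => ?_, fun n p hp => ?_, fun p hp => ?_⟩
  · linarith [(abs_lt.1 (hh' n p)).1, hle n p hp]
  · rw [abs_le]
    constructor <;> linarith [(abs_lt.1 (hh' n p)).1, (abs_lt.1 (hh' n p)).2, hle n p hp, hgC n p,
      (abs_le.1 (hC p hp)).1, h1 n, show 0 < 1 / ((n : ℝ) + 1) by positivity]
  · have hg : Tendsto (fun n => g n p) atTop (𝓝 (u p)) := by
      refine tendsto_order.2 ⟨fun a ha => Eventually.of_forall fun n => ha.trans_le (hle n p hp),
        fun a ha => ?_⟩
      obtain ⟨a', ha', ha''⟩ := exists_between ha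
      obtain ⟨δ, hδ, hball⟩ := Metric.mem_nhdsWithin_iff.1 (hu p hp a' ha')
      obtain ⟨N, hN⟩ := exists_nat_gt ((C - a') / δ)
      filter_upwards [eventually_ge_atTop N] with n hn
      refine lt_of_le_of_lt (ciSup_le fun q => ?_) ha''
      by_cases hq : dist (q : E) p < δ
      · have : u q < a' := hball ⟨hq, q.2⟩
        have : (0 : ℝ) ≤ n * dist p q := by positivity
        linarith
      · rw [not_lt, dist_comm] at hq
        have hnN : (N : ℝ) ≤ n := by exact_mod_cast hn
        have h2 : (C - a') / δ * δ ≤ n * dist p q := by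
          have : (C - a') / δ ≤ n := hN.le.trans hnN
          gcongr
        rw [div_mul_cancel₀ _ hδ.ne'] at h2
        linarith [(abs_le.1 (hC q q.2)).2]
    have hinv : Tendsto (fun n : ℕ => 1 / ((n : ℝ) + 1)) atTop (𝓝 0) :=
      tendsto_one_div_add_atTop_nhds_zero_nat
    have hd : Tendsto (fun n => h n p - g n p) atTop (𝓝 0) :=
      squeeze_zero_norm (fun n => (hh' n p).le) hinv
    have := (hg.add hd).add hinv
    simp only [add_zero] at this
    refine this.congr fun n => by ring

theorem mem_Q_iff {t x : ℝ} : (t, x) ∈ Q ↔ 0 < t := by simp [Q]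

theorem UpperSemicontinuousOn.measurable_slice {u : ℝ × ℝ → ℝ} (hu : UpperSemicontinuousOn u Q)
    {t : ℝ} (ht : 0 < t) (x : ℝ) : Measurable fun z => u (t, x + z) := by
  have h : UpperSemicontinuousOn (u ∘ fun z : ℝ => (t, x + z)) univ :=
    hu.comp (by fun_prop) fun z _ => mem_Q_iff.2 ht
  exact (upperSemicontinuousOn_univ_iff.1 h).measurable

theorem hasDerivAt_quartic (k c e x : ℝ) :
    HasDerivAt (fun y => k * (y - c) ^ 4 + e) (4 * k * (x - c) ^ 3) x := by
  have := ((((hasDerivAt_id x).sub_const c).pow 4).const_mul k).add_const e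
  convert! this using 1
  simp
  ring

/-- Away from the centre `c`, the quartic is kept near `x` and glued outside to smooth majorants
converging to `u`; the maximum survives, and dominated convergence puts `u` back on the annulus r ≤
|z| < ρ. If x = c, the right side is zero and the quartic clause applies. The polynomial in the
inner integral is the Taylor remainder of the quartic. -/
theorem IsRhoSubsolution.deriv_le {W U : ℝ → ℝ} {ρ : ℝ} {u : ℝ × ℝ → ℝ} (hW : IsLevyDensity W)
    (hu : IsRhoSubsolution W U ρ u) {k c t x r : ℝ} {g : ℝ → ℝ} (hk : 0 < k)
    (hg : ContDiffOn ℝ 2 g (Ioi 0)) (ht : 0 < t)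
    (hmax : ∀ s y, 0 < s → u (s, y) - (k * (y - c) ^ 4 + g s) ≤ u (t, x) - (k * (x - c) ^ 4 + g t))
    (hr : 0 < r) (hrρ : r < ρ) :
    deriv g t ≤ ((∫ z in Ioo (-r) r, k * (6 * (x - c) ^ 2 * z ^ 2 + 4 * (x - c) * z ^ 3 + z ^ 4) * W z)
      + (∫ z in (Ioo (-r) r)ᶜ, (u (t, x + z) - u (t, x)) * W z) + deriv U x)
      * |4 * k * (x - c) ^ 3| := by
  obtain ⟨husc, ⟨C, hC⟩, htest⟩ := hu
  have htQ : (t, x) ∈ Q := mem_Q_iff.2 ht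
  rcases eq_or_ne x c with rfl | hxc
  · have hφ : ContDiffOn ℝ 2 (fun p : ℝ × ℝ => k * (p.2 - x) ^ 4 + g p.1) Q := by
      refine ContDiffOn.add (ContDiff.contDiffOn (by fun_prop)) ?_
      exact hg.comp contDiff_fst.contDiffOn fun p hp => hp.1
    have := (htest _ hφ t x htQ (fun p hp => hmax p.1 p.2 hp.1)).2 ⟨k, g, hg, fun s y _ => by
      rw [Even.pow_abs (by decide)]⟩
    simpa [partialT] using this
  set c₀ := u (t, x) - (k * (x - c) ^ 4 + g t) with hc₀
  set φ₀ : ℝ × ℝ → ℝ := fun p => k * (p.2 - c) ^ 4 + (g p.1 + c₀) with hφ₀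
  have hφ₀u : ∀ p ∈ Q, u p ≤ φ₀ p := fun p hp => by
    have := hmax p.1 p.2 hp.1
    simp only [hφ₀]
    linarith
  have hφ₀tx : φ₀ (t, x) = u (t, x) := by simp only [hφ₀, hc₀]; ring
  have hφ₀c : ContDiffOn ℝ 2 φ₀ Q := by
    refine ContDiffOn.add (ContDiff.contDiffOn (by fun_prop)) (ContDiffOn.add ?_ contDiffOn_const)
    exact hg.comp contDiff_fst.contDiffOn fun p hp => hp.1
  obtain ⟨h, hsm, hge, hbd, hlim⟩ := husc.exists_contDiff_tendsto ⟨_, htQ⟩ hC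
  let B : ℕ → ContDiffBump x := fun n =>
    ⟨r, r + 1 / ((n : ℝ) + 1), hr, lt_add_of_pos_right _ (by positivity)⟩
  let φ : ℕ → ℝ × ℝ → ℝ := fun n p => B n p.2 * φ₀ p + (1 - B n p.2) * h n p
  have hB1 : ∀ n y, |y - x| ≤ r → B n y = 1 := fun n y hy =>
    (B n).one_of_mem_closedBall (by simpa [Real.dist_eq] using hy)
  have hφc : ∀ n, ContDiffOn ℝ 2 (φ n) Q := fun n => by
    have hb : ContDiffOn ℝ 2 (fun p : ℝ × ℝ => B n p.2) Q :=
      ((B n).contDiff.comp contDiff_snd).contDiffOn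
    have hh : ContDiffOn ℝ 2 (h n) Q := (contDiff_infty.1 (hsm n) 2).contDiffOn
    exact (hb.mul hφ₀c).add ((contDiffOn_const.sub hb).mul hh)
  have hφu : ∀ n, ∀ p ∈ Q, u p ≤ φ n p := fun n p hp => by
    have h1 := mul_le_mul_of_nonneg_left (hφ₀u p hp) (B n).nonneg (a := B n p.2)
    have h2 := mul_le_mul_of_nonneg_left (hge n p hp) (sub_nonneg.2 ((B n).le_one (x := p.2)))
    simp only [φ]
    linarith
  have hφeq : ∀ n s y, |y - x| ≤ r → φ n (s, y) = φ₀ (s, y) := fun n s y hy => by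
    simp [φ, hB1 n y hy]
  have hφtx : ∀ n, φ n (t, x) = u (t, x) := fun n => by
    rw [hφeq n t x (by simpa using hr.le), hφ₀tx]
  have hDx : ∀ n, deriv (fun y => φ n (t, y)) x = 4 * k * (x - c) ^ 3 := fun n => by
    have : (fun y => φ n (t, y)) =ᶠ[𝓝 x] fun y => k * (y - c) ^ 4 + (g t + c₀) := by
      filter_upwards [Metric.closedBall_mem_nhds x hr] with y hy
      exact hφeq n t y (by simpa [Real.dist_eq] using hy)
    rw [this.deriv_eq, (hasDerivAt_quartic _ _ _ _).deriv]
  have hDt : ∀ n, deriv (fun s => φ n (s, x)) t = deriv g t := fun n => by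
    have : (fun s => φ n (s, x)) = fun s => k * (x - c) ^ 4 + (g s + c₀) :=
      funext fun s => hφeq n s x (by simpa using hr.le)
    rw [this]
    simp
  set D := 4 * k * (x - c) ^ 3 with hD
  have hD0 : D ≠ 0 := by
    rw [hD]
    have := sub_ne_zero.2 hxc
    positivity
  set A : Set ℝ := Ioo (-ρ) ρ \ Ioo (-r) r with hA
  have hAm : MeasurableSet A := measurableSet_Ioo.diff measurableSet_Ioo
  have hsubr : Ioo (-r) r ⊆ Ioo (-ρ) ρ := Ioo_subset_Ioo (by linarith) hrρ.le
  have hWA : IntegrableOn W A := (hW.integrableOn_compl hr).mono_set fun z hz => hz.2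
  set I₀ := ∫ z in Ioo (-r) r, k * (6 * (x - c) ^ 2 * z ^ 2 + 4 * (x - c) * z ^ 3 + z ^ 4) * W z
    with hI₀
  set I₁ := ∫ z in (Ioo (-ρ) ρ)ᶜ, (u (t, x + z) - u (t, x)) * W z with hI₁
  set M := (k * (|x - c| + ρ) ^ 4 + |g t + c₀|) + (C + 2) with hM
  have hφM : ∀ n, ∀ z ∈ A, ‖φ n (t, x + z)‖ ≤ M := by
    intro n z hz
    have hz' : |z| < ρ := abs_lt.2 hz.1
    have hxz : (t, x + z) ∈ Q := mem_Q_iff.2 ht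
    have h1 : |φ₀ (t, x + z)| ≤ k * (|x - c| + ρ) ^ 4 + |g t + c₀| := by
      simp only [hφ₀]
      refine (abs_add_le _ _).trans ?_
      rw [abs_mul, abs_of_pos hk, abs_pow]
      gcongr
      rw [show x + z - c = (x - c) + z by ring]
      exact (abs_add_le _ _).trans (by gcongr)
    have h2 := hbd n _ hxz
    have hb0 : 0 ≤ B n (x + z) := (B n).nonneg
    have hb1 : B n (x + z) ≤ 1 := (B n).le_one
    simp only [φ, Real.norm_eq_abs]
    refine (abs_add_le _ _).trans ?_
    rw [abs_mul, abs_mul, abs_of_nonneg hb0, abs_of_nonneg (sub_nonneg.2 hb1)]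
    refine add_le_add ((mul_le_of_le_one_left (abs_nonneg _) hb1).trans h1)
      ((mul_le_of_le_one_left (abs_nonneg _) (by linarith)).trans h2)
  have hφcont : ∀ n, Continuous fun z => φ n (t, x + z) := fun n => by
    have := (hsm n).continuous
    have := (B n).continuous
    simp only [φ, hφ₀]
    fun_prop
  have hmeas : ∀ n, AEStronglyMeasurable (fun z => (φ n (t, x + z) - u (t, x)) * W z)
      (volume.restrict A) := fun n =>
    ((hφcont n).sub continuous_const).aestronglyMeasurable.mul hW.aestronglyMeasurable.restrict
  have hbound : ∀ n, ∀ᵐ z ∂volume.restrict A,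
      ‖(φ n (t, x + z) - u (t, x)) * W z‖ ≤ (M + C) * ‖W z‖ := fun n => by
    refine (ae_restrict_mem hAm).mono fun z hz => ?_
    rw [norm_mul]
    gcongr
    exact (norm_sub_le _ _).trans (add_le_add (hφM n z hz) (hC _ htQ))
  have hInt : ∀ n, IntegrableOn (fun z => (φ n (t, x + z) - u (t, x)) * W z) A := fun n =>
    (hWA.norm.const_mul (M + C)).mono' (hmeas n) (hbound n)
  have hid := hW.integrableOn_annulus_id (R := ρ) hr
  have hinner : IntegrableOn
      (fun z => k * (6 * (x - c) ^ 2 * z ^ 2 + 4 * (x - c) * z ^ 3 + z ^ 4) * W z) (Ioo (-r) r) := by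
    have h1 : IntegrableOn (fun z => (k * (6 * (x - c) ^ 2 + 4 * (x - c) * z + z ^ 2)) *
        (z ^ 2 * W z)) (Ioo (-r) r) := by
      refine Integrable.bdd_mul (c := k * (6 * (x - c) ^ 2 + 4 * |x - c| * r + r ^ 2))
        (hW.integrableOn_sq r) (Continuous.aestronglyMeasurable (by fun_prop)) ?_
      refine (ae_restrict_mem measurableSet_Ioo).mono fun z hz => ?_
      have hz' : |z| ≤ r := (abs_lt.2 hz).le
      rw [norm_mul, Real.norm_of_nonneg hk.le, Real.norm_eq_abs]
      gcongr
      refine (abs_add_le _ _).trans (add_le_add ((abs_add_le _ _).trans (add_le_add ?_ ?_)) ?_)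
      · rw [abs_of_nonneg (by positivity)]
      · rw [abs_mul, abs_mul, abs_of_pos (by norm_num : (0 : ℝ) < 4)]
        gcongr
      · rw [abs_pow]
        gcongr
    refine h1.congr_fun (fun z _ => ?_) measurableSet_Ioo
    simp only
    ring
  have hstep : ∀ n, deriv g t ≤
      (I₀ + (∫ z in A, (φ n (t, x + z) - u (t, x)) * W z) + I₁ + deriv U x) * |D| := by
    intro n
    have hmaxn : IsMaxOn (fun p => u p - φ n p) Q (t, x) := fun p hp => by
      have := hφu n p hp
      simp only [mem_ofPred_eq, hφtx]
      linarith
    have h1 := (htest _ (hφc n) t x htQ hmaxn).1 (by rw [partialX, hDx]; exact hD0)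
    rw [partialT, hDt, hamiltonian, partialX, hDx, nonlocalOp, hDx, ← hI₁] at h1
    convert h1 using 4
    rw [← union_sdiff_cancel hsubr]
    have e1 : EqOn (fun z => (φ n (t, x + z) - φ n (t, x) - D * z) * W z)
        (fun z => k * (6 * (x - c) ^ 2 * z ^ 2 + 4 * (x - c) * z ^ 3 + z ^ 4) * W z)
        (Ioo (-r) r) := fun z hz => by
      have hz' : |x + z - x| ≤ r := by simpa using (abs_lt.2 hz).le
      simp only [hφeq n t _ hz', hφeq n t x (by simpa using hr.le), hφ₀, hD]
      ring
    have e2 : EqOn (fun z => (φ n (t, x + z) - φ n (t, x) - D * z) * W z)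
        (fun z => (φ n (t, x + z) - u (t, x)) * W z - D * (z * W z)) A := fun z _ => by
      simp only [hφtx]
      ring
    have i2 := (hInt n).sub (hid.const_mul D)
    rw [setIntegral_union disjoint_sdiff_right hAm ((integrableOn_congr_fun e1 measurableSet_Ioo).2
      hinner) ((integrableOn_congr_fun e2 hAm).2 i2), setIntegral_congr_fun measurableSet_Ioo e1,
      setIntegral_congr_fun hAm e2, integral_sub (hInt n) (hid.const_mul D), integral_const_mul,
      hW.integral_annulus_id, mul_zero, sub_zero]
  have htend : Tendsto (fun n => ∫ z in A, (φ n (t, x + z) - u (t, x)) * W z) atTop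
      (𝓝 (∫ z in A, (u (t, x + z) - u (t, x)) * W z)) := by
    refine tendsto_integral_of_dominated_convergence _ hmeas (hWA.norm.const_mul (M + C)) hbound ?_
    -- The points z = ±r must be discarded: every cutoff equals 1 there, so the glued functions need
    -- not converge to `u`.
    filter_upwards [ae_restrict_mem hAm, ae_restrict_of_ae (Measure.ae_ne volume r),
      ae_restrict_of_ae (Measure.ae_ne volume (-r))] with z hz hz1 hz2
    have hrz : r < |z| := by
      have h1 : r ≤ |z| := by
        have := hz.2
        rwa [mem_Ioo, ← abs_lt, not_lt] at this
      refine lt_of_le_of_ne h1 fun he => ?_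
      rcases abs_choice z with h | h
      · exact hz1 (by rw [he, h])
      · exact hz2 (by rw [he, h]; ring)
    have hrout : Tendsto (fun n => (B n).rOut) atTop (𝓝 r) := by
      have := tendsto_one_div_add_atTop_nhds_zero_nat (𝕜 := ℝ).const_add r
      simpa [B] using this
    refine (Tendsto.sub_const ?_ _).mul_const _
    refine (hlim (t, x + z) (mem_Q_iff.2 ht)).congr' ?_
    filter_upwards [hrout.eventually_lt_const hrz] with n hn
    have : B n (x + z) = 0 := (B n).zero_of_le_dist (by simpa [Real.dist_eq] using hn.le)
    simp [φ, this]
  have hfin := ge_of_tendsto' ((((htend.const_add I₀).add_const I₁).add_const (deriv U x)).mul_const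
    |D|) hstep
  have hFb : IntegrableOn (fun z => (u (t, x + z) - u (t, x)) * W z) (Ioo (-r) r)ᶜ :=
    hW.integrableOn_compl_mul hr (K := C + C) ((husc.measurable_slice ht x).sub_const _) fun z => by
      rw [← Real.norm_eq_abs]
      exact (norm_sub_le _ _).trans (add_le_add (hC _ (mem_Q_iff.2 ht)) (hC _ htQ))
  rw [IsLevyDensity.compl_Ioo_eq_union hrρ.le] at hFb ⊢
  rw [setIntegral_union (IsLevyDensity.disjoint_annulus r ρ) measurableSet_Ioo.compl
    hFb.left_of_union hFb.right_of_union]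
  rwa [add_assoc I₀] at hfin

/-- The nonlocal operator is odd and |u_x| is even, so a sign change preserves the equation except
for reversing the forcing. -/
theorem IsRhoSupersolution.neg {W U : ℝ → ℝ} {ρ : ℝ} {v : ℝ × ℝ → ℝ}
    (hv : IsRhoSupersolution W U ρ v) :
    IsRhoSubsolution W (fun x => -U x) ρ (fun p => -v p) := by
  obtain ⟨hlsc, ⟨C, hC⟩, htest⟩ := hv
  refine ⟨hlsc.neg, ⟨C, fun p hp => by rw [abs_neg]; exact hC p hp⟩,
    fun φ hφ t x htx hmax => ?_⟩
  have hmin : IsMinOn (fun p => v p - -φ p) Q (t, x) := fun p hp => by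
    have := hmax hp
    simp only [mem_ofPred_eq] at this ⊢
    linarith
  obtain ⟨h1, h2⟩ := htest (fun p => -φ p) hφ.neg t x htx hmin
  have hT : partialT (fun p => -φ p) t x = -partialT φ t x := deriv.fun_neg
  have hX : partialX (fun p => -φ p) t x = -partialX φ t x := deriv.fun_neg
  have hX' : deriv (fun y => -φ (t, y)) x = -deriv (fun y => φ (t, y)) x := deriv.fun_neg
  have hU' : deriv (fun x => -U x) x = -deriv U x := deriv.fun_neg
  refine ⟨fun hne => ?_, fun ⟨θ, g, hg, hq⟩ => ?_⟩
  · have := h1 (by rwa [hX, neg_ne_zero])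
    rw [hT] at this
    have hH : hamiltonian W U ρ (fun p => -φ p) v t x
        = -hamiltonian W (fun x => -U x) ρ φ (fun p => -v p) t x := by
      simp only [hamiltonian, nonlocalOp, hX, hX', hU', abs_neg]
      rw [← neg_mul, neg_add, neg_add, ← integral_neg, ← integral_neg, neg_neg]
      congr 4 <;> ext z <;> ring
    linarith
  · have := h2 ⟨-θ, fun t => -g t, hg.neg, fun s y hs => by simp only [hq s y hs]; ring⟩
    rw [hT] at this
    linarith

/-! ### Initial layer and logarithmic confinement -/

/-- An initial upper bound holds uniformly on bounded sets for short times. -/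
theorem exists_forall_le_of_eventually_nhdsWithin {u : ℝ × ℝ → ℝ} {u₀ : ℝ → ℝ} (hu₀ : Continuous u₀)
    (h : ∀ x : ℝ, ∀ σ > 0, ∀ᶠ p in 𝓝[Q] ((0 : ℝ), x), u p < u₀ x + σ) (R : ℝ) {σ : ℝ} (hσ : 0 < σ) :
    ∃ τ > 0, ∀ t x, 0 < t → t < τ → |x| ≤ R → u (t, x) ≤ u₀ x + σ := by
  have := (isCompact_Icc (a := -R) (b := R)).eventually_forall_of_forall_eventually (x₀ := (0 : ℝ))
    (P := fun t x => 0 < t → u (t, x) ≤ u₀ x + σ) (fun x _ => by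
      have h1 := eventually_nhdsWithin_iff.1 (h x (σ / 2) (half_pos hσ))
      have h2 : ∀ᶠ p : ℝ × ℝ in 𝓝 ((0 : ℝ), x), u₀ x - σ / 2 < u₀ p.2 :=
        (hu₀.comp continuous_snd).continuousAt.eventually_const_lt (by simp; linarith)
      filter_upwards [h1, h2] with p hp1 hp2 hp
      have : u p < _ := hp1 (mem_Q_iff.2 hp)
      exact (by linarith : u p ≤ u₀ p.2 + σ))
  obtain ⟨τ, hτ, hball⟩ := Metric.eventually_nhds_iff.1 this
  refine ⟨τ, hτ, fun t x ht htτ hx => hball ?_ x (abs_le.1 hx) ht⟩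
  rw [Real.dist_eq, sub_zero, abs_of_pos ht]
  exact htτ

/-- This is log q ≤ q - 1 at the quotient of the two arguments. The quadratic coefficient is uniform
in `a`, so confinement costs O(δ) in the nonlocal terms. -/
theorem log_one_add_sq_add_le (a z : ℝ) :
    Real.log (1 + (a + z) ^ 2) ≤ Real.log (1 + a ^ 2) + 2 * a / (1 + a ^ 2) * z + z ^ 2 := by
  have h1 : 0 < 1 + a ^ 2 := by positivity
  have h2 : 0 < 1 + (a + z) ^ 2 := by positivity
  have h3 := Real.log_le_sub_one_of_pos (div_pos h2 h1)
  rw [Real.log_div h2.ne' h1.ne'] at h3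
  have h4 : (1 + (a + z) ^ 2) / (1 + a ^ 2) - 1 = 2 * a / (1 + a ^ 2) * z + z ^ 2 / (1 + a ^ 2) := by
    field_simp
    ring
  have h5 : z ^ 2 / (1 + a ^ 2) ≤ z ^ 2 := div_le_self (sq_nonneg z) (by nlinarith)
  linarith

theorem hasDerivAt_log_one_add_sq (a : ℝ) :
    HasDerivAt (fun a => Real.log (1 + a ^ 2)) (2 * a / (1 + a ^ 2)) a := by
  have h : HasDerivAt (fun a : ℝ => 1 + a ^ 2) (2 * a) a := by
    simpa using (hasDerivAt_pow 2 a).const_add 1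
  exact h.log (by positivity)

theorem abs_two_mul_div_one_add_sq_le (a : ℝ) : |2 * a / (1 + a ^ 2)| ≤ 1 := by
  rw [abs_div, abs_of_pos (by positivity : 0 < 1 + a ^ 2), div_le_one (by positivity), abs_mul,
    abs_two, ← sq_abs a]
  nlinarith [sq_nonneg (|a| - 1)]

/-- The slope of the logarithm decays like 1/|a|, which balances the linear growth of U'. -/
theorem abs_mul_abs_two_mul_div_one_add_sq_le (a : ℝ) : |a| * |2 * a / (1 + a ^ 2)| ≤ 2 := by
  rw [abs_div, abs_of_pos (by positivity : 0 < 1 + a ^ 2), abs_mul, abs_two, ← mul_div_assoc,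
    div_le_iff₀ (by positivity)]
  nlinarith [sq_abs a]

/-! ### The doubled function and its maximum -/

/-- Doubling of variables: the points `x` and `y` are penalised towards auxiliary points `a`, `b`,
which in turn are penalised towards each other and confined. -/
noncomputable def doubling (u w : ℝ × ℝ → ℝ) (k n lam δ γ m t x s y a b : ℝ) : ℝ :=
  u (t, x) + w (s, y) - (k * (x - a) ^ 4 + k * (y - b) ^ 4 + n * Real.exp (lam * t) * (a - b) ^ 2
    + δ * Real.log (1 + a ^ 2) + γ * t + m * (t - s) ^ 2)

theorem log_one_add_sq_nonneg (a : ℝ) : 0 ≤ Real.log (1 + a ^ 2) :=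
  Real.log_nonneg (by nlinarith [sq_nonneg a])

section Doubling

variable {u w : ℝ × ℝ → ℝ} {C k n lam δ γ m : ℝ}

/-- Since u + w ≤ 2C, no single penalty can exceed 2C where the doubled function is nonnegative. -/
theorem doubling_penalty_le (huC : ∀ p ∈ Q, |u p| ≤ C) (hwC : ∀ p ∈ Q, |w p| ≤ C) (hk : 0 < k)
    (hn : 0 < n) (hδ : 0 < δ) (hγ : 0 < γ) (hm : 0 < m) {t x s y a b : ℝ} (ht : 0 < t) (hs : 0 < s)
    (h : 0 ≤ doubling u w k n lam δ γ m t x s y a b) :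
    k * (x - a) ^ 4 ≤ 2 * C ∧ k * (y - b) ^ 4 ≤ 2 * C ∧
      n * Real.exp (lam * t) * (a - b) ^ 2 ≤ 2 * C ∧ δ * Real.log (1 + a ^ 2) ≤ 2 * C ∧
      γ * t ≤ 2 * C ∧ m * (t - s) ^ 2 ≤ 2 * C := by
  have h1 := (abs_le.1 (huC _ (mem_Q_iff.2 ht : (t, x) ∈ Q))).2
  have h2 := (abs_le.1 (hwC _ (mem_Q_iff.2 hs : (s, y) ∈ Q))).2
  have e1 : 0 ≤ k * (x - a) ^ 4 := by positivity
  have e2 : 0 ≤ k * (y - b) ^ 4 := by positivity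
  have e3 : 0 ≤ n * Real.exp (lam * t) * (a - b) ^ 2 := by positivity
  have e4 : 0 ≤ δ * Real.log (1 + a ^ 2) := mul_nonneg hδ.le (log_one_add_sq_nonneg a)
  have e5 : 0 ≤ γ * t := by positivity
  have e6 : 0 ≤ m * (t - s) ^ 2 := by positivity
  rw [doubling] at h
  refine ⟨?_, ?_, ?_, ?_, ?_, ?_⟩ <;> linarith

theorem abs_le_one_add_of_sq_le {z M : ℝ} (h : z ^ 2 ≤ M) : |z| ≤ 1 + M := by
  rw [← sq_abs] at h
  nlinarith [sq_nonneg (|z| - 1)]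

theorem abs_le_one_add_of_pow_four_le {z M : ℝ} (h : z ^ 4 ≤ M) : |z| ≤ 1 + M := by
  have : |z| ^ 4 ≤ M := by rwa [Even.pow_abs (by decide)]
  nlinarith [sq_nonneg (|z| ^ 2 - 1), sq_nonneg (|z| - 1)]

theorem abs_le_exp_of_log_le {a M : ℝ} (h : Real.log (1 + a ^ 2) ≤ M) : |a| ≤ Real.exp M := by
  rw [Real.log_le_iff_le_exp (by positivity), ← sq_abs] at h
  nlinarith [sq_nonneg (|a| - 1)]

/-- The penalties confine the superlevel set at `σ` to a compact box; `hpos` keeps both times away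
from 0, so the box lies where semicontinuity is available. -/
theorem exists_isMaxOn_doubling (hu : UpperSemicontinuousOn u Q) (hw : UpperSemicontinuousOn w Q)
    (huC : ∀ p ∈ Q, |u p| ≤ C) (hwC : ∀ p ∈ Q, |w p| ≤ C) (hk : 0 < k)
    (hn : 0 < n) (hlam : 0 ≤ lam) (hδ : 0 < δ) (hγ : 0 < γ) (hm : 0 < m) {σ τ : ℝ} (hσ : 0 ≤ σ)
    (hτ : 0 < τ)
    (hpos : ∀ t x s y a b, 0 < t → 0 < s → σ ≤ doubling u w k n lam δ γ m t x s y a b →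
      τ ≤ t ∧ τ ≤ s)
    {t₀ x₀ s₀ y₀ a₀ b₀ : ℝ} (ht₀ : 0 < t₀) (hs₀ : 0 < s₀)
    (h₀ : σ ≤ doubling u w k n lam δ γ m t₀ x₀ s₀ y₀ a₀ b₀) :
    ∃ t x s y a b, 0 < t ∧ 0 < s ∧ σ ≤ doubling u w k n lam δ γ m t x s y a b ∧
      ∀ t' x' s' y' a' b', 0 < t' → 0 < s' →
        doubling u w k n lam δ γ m t' x' s' y' a' b' ≤ doubling u w k n lam δ γ m t x s y a b := by
  set N := 2 * C
  set A := Real.exp (N / δ)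
  set B := A + (1 + N / n)
  set X := (1 + N / k) + B
  set T := N / γ
  set S := T + (1 + N / m)
  let K : Set (((ℝ × ℝ) × (ℝ × ℝ)) × (ℝ × ℝ)) :=
    ((Icc τ T ×ˢ Icc (-X) X) ×ˢ (Icc τ S ×ˢ Icc (-X) X)) ×ˢ (Icc (-B) B ×ˢ Icc (-B) B)
  have hKc : IsCompact K := ((isCompact_Icc.prod isCompact_Icc).prod
    (isCompact_Icc.prod isCompact_Icc)).prod (isCompact_Icc.prod isCompact_Icc)
  have hmem : ∀ t x s y a b, 0 < t → 0 < s → σ ≤ doubling u w k n lam δ γ m t x s y a b →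
      (((t, x), (s, y)), (a, b)) ∈ K := by
    intro t x s y a b ht hs h
    obtain ⟨h1, h2, h3, h4, h5, h6⟩ :=
      doubling_penalty_le huC hwC hk hn hδ hγ hm ht hs (hσ.trans h)
    obtain ⟨hτt, hτs⟩ := hpos t x s y a b ht hs h
    have hN : 0 ≤ N := le_trans (by positivity) h1
    have hexp : 1 ≤ Real.exp (lam * t) := Real.one_le_exp (by positivity)
    have b1 : |x - a| ≤ 1 + N / k := abs_le_one_add_of_pow_four_le (by rwa [le_div_iff₀' hk])
    have b2 : |y - b| ≤ 1 + N / k := abs_le_one_add_of_pow_four_le (by rwa [le_div_iff₀' hk])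
    have b3 : |a - b| ≤ 1 + N / n := abs_le_one_add_of_sq_le (by
      rw [le_div_iff₀' hn]
      refine le_trans ?_ h3
      gcongr
      exact le_mul_of_one_le_right hn.le hexp)
    have b4 : |a| ≤ A := abs_le_exp_of_log_le (by rwa [le_div_iff₀' hδ])
    have b5 : t ≤ T := by rwa [le_div_iff₀' hγ]
    have b6 : |t - s| ≤ 1 + N / m := abs_le_one_add_of_sq_le (by rwa [le_div_iff₀' hm])
    rw [abs_le] at b1 b2 b3 b4 b6
    have hnn : 0 ≤ N / n := by positivity
    simp only [K, mem_prod, mem_Icc, X, B, S]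
    refine ⟨⟨⟨⟨hτt, b5⟩, ?_, ?_⟩, ⟨hτs, ?_⟩, ?_, ?_⟩, ⟨?_, ?_⟩, ?_, ?_⟩ <;> linarith
  let F : ((ℝ × ℝ) × (ℝ × ℝ)) × (ℝ × ℝ) → ℝ := fun p =>
    doubling u w k n lam δ γ m p.1.1.1 p.1.1.2 p.1.2.1 p.1.2.2 p.2.1 p.2.2
  have hKQ : ∀ p ∈ K, p.1.1 ∈ Q ∧ p.1.2 ∈ Q := fun p hp =>
    ⟨mem_Q_iff.2 (hτ.trans_le hp.1.1.1.1), mem_Q_iff.2 (hτ.trans_le hp.1.2.1.1)⟩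
  have hF : UpperSemicontinuousOn F K := by
    have f1 : UpperSemicontinuousOn (u ∘ fun p : ((ℝ × ℝ) × (ℝ × ℝ)) × (ℝ × ℝ) => p.1.1) K :=
      hu.comp (by fun_prop) fun p hp => (hKQ p hp).1
    have f2 : UpperSemicontinuousOn (w ∘ fun p : ((ℝ × ℝ) × (ℝ × ℝ)) × (ℝ × ℝ) => p.1.2) K :=
      hw.comp (by fun_prop) fun p hp => (hKQ p hp).2
    have f3 : Continuous fun p : ((ℝ × ℝ) × (ℝ × ℝ)) × (ℝ × ℝ) =>
        -(k * (p.1.1.2 - p.2.1) ^ 4 + k * (p.1.2.2 - p.2.2) ^ 4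
          + n * Real.exp (lam * p.1.1.1) * (p.2.1 - p.2.2) ^ 2 + δ * Real.log (1 + p.2.1 ^ 2)
          + γ * p.1.1.1 + m * (p.1.1.1 - p.1.2.1) ^ 2) := by
      have : Continuous fun p : ((ℝ × ℝ) × (ℝ × ℝ)) × (ℝ × ℝ) => Real.log (1 + p.2.1 ^ 2) :=
        Continuous.log (by fun_prop) fun p => by positivity
      fun_prop
    exact (f1.add f2).add f3.continuousOn.upperSemicontinuousOn
  obtain ⟨⟨⟨⟨t, x⟩, ⟨s, y⟩⟩, ⟨a, b⟩⟩, hK, hmax⟩ :=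
    hF.exists_isMaxOn ⟨_, hmem t₀ x₀ s₀ y₀ a₀ b₀ ht₀ hs₀ h₀⟩ hKc
  have hge : σ ≤ doubling u w k n lam δ γ m t x s y a b :=
    h₀.trans (hmax (hmem t₀ x₀ s₀ y₀ a₀ b₀ ht₀ hs₀ h₀))
  refine ⟨t, x, s, y, a, b, mem_Q_iff.1 (hKQ _ hK).1, mem_Q_iff.1 (hKQ _ hK).2, hge,
    fun t' x' s' y' a' b' ht' hs' => ?_⟩
  by_contra! hlt
  exact hlt.not_ge (hmax (hmem t' x' s' y' a' b' ht' hs' (hge.trans hlt.le)))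

end Doubling

/-! ### Viscosity inequalities at the maximum -/

theorem IsLevyDensity.quartic_integral_le {W : ℝ → ℝ} (hW : IsLevyDensity W) {k p r : ℝ}
    (hk : 0 ≤ k) (hr1 : r ≤ 1) :
    ∫ z in Ioo (-r) r, k * (6 * p ^ 2 * z ^ 2 + 4 * p * z ^ 3 + z ^ 4) * W z ≤
      k * (6 * p ^ 2 + 4 * |p| + 1) * ∫ z in Ioo (-r) r, z ^ 2 * W z := by
  rw [← integral_const_mul]
  refine integral_mono_of_nonneg ?_ ((hW.integrableOn_sq r).const_mul _) ?_
  · refine ae_restrict_of_ae (hW.nonneg.mono fun z hz => ?_)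
    have : 0 ≤ 6 * p ^ 2 * z ^ 2 + 4 * p * z ^ 3 + z ^ 4 := by
      have : 6 * p ^ 2 * z ^ 2 + 4 * p * z ^ 3 + z ^ 4 = z ^ 2 * ((2 * p + z) ^ 2 + 2 * p ^ 2) := by
        ring
      rw [this]
      positivity
    simp only [Pi.zero_apply]
    positivity
  · filter_upwards [ae_restrict_of_ae hW.nonneg, ae_restrict_mem measurableSet_Ioo] with z hz hzr
    have hz1 : |z| ≤ 1 := (abs_lt.2 hzr).le.trans hr1
    have h1 : p * z ≤ |p| := by
      calc p * z ≤ |p * z| := le_abs_self _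
        _ = |p| * |z| := abs_mul _ _
        _ ≤ |p| := mul_le_of_le_one_right (abs_nonneg _) hz1
    have h2 : z ^ 2 ≤ 1 := by rw [← sq_abs]; nlinarith [abs_nonneg z]
    have h3 : 6 * p ^ 2 * z ^ 2 + 4 * p * z ^ 3 + z ^ 4 ≤ (6 * p ^ 2 + 4 * |p| + 1) * z ^ 2 := by
      nlinarith [sq_nonneg z, mul_le_mul_of_nonneg_left h1 (sq_nonneg z)]
    rw [← mul_assoc, mul_assoc k _ (z ^ 2)]
    gcongr

/-- Pair the two terms at the smaller of |P| and |P'|, where only I + J counts; the excess has size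
at most `e` and multiplies one of `I`, `J`. Only upper bounds enter, as the nonlocal terms have no
useful lower bound. -/
theorem mul_abs_add_mul_abs_le {I J B m P P' e : ℝ} (hI : I ≤ B) (hJ : J ≤ B) (hIJ : I + J ≤ m)
    (hm : 0 ≤ m) (hB : 0 ≤ B) (he : |P - P'| ≤ e) : I * |P| + J * |P'| ≤ m * |P'| + B * e := by
  have h1 := abs_le.1 ((abs_abs_sub_abs_le_abs_sub P P').trans he)
  rcases le_total |P'| |P| with h | h
  · have := mul_le_mul_of_nonneg_right hIJ (abs_nonneg P')
    have h2 : I * (|P| - |P'|) ≤ B * e :=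
      (mul_le_mul_of_nonneg_right hI (sub_nonneg.2 h)).trans (mul_le_mul_of_nonneg_left h1.2 hB)
    nlinarith
  · have := mul_le_mul_of_nonneg_right hIJ (abs_nonneg P)
    have h2 : J * (|P'| - |P|) ≤ B * e :=
      (mul_le_mul_of_nonneg_right hJ (sub_nonneg.2 h)).trans
        (mul_le_mul_of_nonneg_left (by linarith) hB)
    have h3 := mul_le_mul_of_nonneg_left h hm
    nlinarith

/-- The viscosity inequalities at a maximum point of the doubled function. -/
theorem doubling_max_inequality {W U : ℝ → ℝ} (hW : IsLevyDensity W) {ρ₁ ρ₂ : ℝ}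
    {u w : ℝ × ℝ → ℝ} {C k n lam δ γ m : ℝ} {L : ℝ≥0} (hρ₁ : 0 < ρ₁) (hρ₂ : 0 < ρ₂)
    (hu : IsRhoSubsolution W U ρ₁ u) (hw : IsRhoSubsolution W (fun x => -U x) ρ₂ w)
    (hL : LipschitzWith L (deriv U))
    (huC : ∀ p ∈ Q, |u p| ≤ C) (hwC : ∀ p ∈ Q, |w p| ≤ C) (hk : 0 < k)
    (hn : 0 < n) (hδ : 0 < δ)
    {t x s y a b : ℝ} (ht : 0 < t) (hs : 0 < s)
    (hmax : ∀ t' x' s' y' a' b', 0 < t' → 0 < s' →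
      doubling u w k n lam δ γ m t' x' s' y' a' b' ≤ doubling u w k n lam δ γ m t x s y a b)
    {θ J T R : ℝ} (hθ : n * Real.exp (lam * t) = θ) (hR : 0 < R)
    (hJ : ∫ z in Ioo (-R) R, z ^ 2 * W z = J) (hT : ∫ z in (Ioo (-R) R)ᶜ, W z = T) :
    lam * θ * (a - b) ^ 2 + γ ≤ L * |x - y| * |2 * θ * (a - b)|
      + |deriv U x| * (δ * |2 * a / (1 + a ^ 2)|)
      + (δ * J + 4 * C * T) * |2 * θ * (a - b)| + ((θ + δ) * J + 2 * C * T) * δ := by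
  have hθ0 : 0 < θ := by rw [← hθ]; positivity
  have hJ0 : 0 ≤ J := hJ ▸ hW.sq_integral_nonneg _
  have hT0 : 0 ≤ T := hT ▸ hW.tail_nonneg _
  have hC0 : 0 ≤ C := (abs_nonneg _).trans (huC _ (mem_Q_iff.2 ht : (t, (0 : ℝ)) ∈ Q))
  set d := a - b with hd
  set q := 2 * a / (1 + a ^ 2) with hq
  simp only [doubling] at hmax
  have hP1 : 4 * k * (x - a) ^ 3 = 2 * θ * d + δ * q := by
    have hloc : IsLocalMax (fun a' => -(k * (x - a') ^ 4 + θ * (a' - b) ^ 2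
        + δ * Real.log (1 + a' ^ 2))) a := Eventually.of_forall fun a' => by
      have := hmax t x s y a' b ht hs
      rw [hθ] at this
      linarith
    have hder : HasDerivAt (fun a' => -(k * (x - a') ^ 4 + θ * (a' - b) ^ 2
        + δ * Real.log (1 + a' ^ 2))) (-(-(4 * k * (x - a) ^ 3) + θ * (2 * (a - b)) + δ * q)) a := by
      have h1 : HasDerivAt (fun a' => k * (x - a') ^ 4) (-(4 * k * (x - a) ^ 3)) a := by
        have := (((hasDerivAt_id a).const_sub x).pow 4).const_mul k
        convert! this using 1
        simp
        ring
      have h2 : HasDerivAt (fun a' => θ * (a' - b) ^ 2) (θ * (2 * (a - b))) a := by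
        have := (((hasDerivAt_id a).sub_const b).pow 2).const_mul θ
        convert! this using 1
        simp
      exact ((h1.add h2).add ((hasDerivAt_log_one_add_sq a).const_mul δ)).neg
    have := hloc.hasDerivAt_eq_zero hder
    rw [hd]
    linarith
  have hP2 : 4 * k * (y - b) ^ 3 = -(2 * θ * d) := by
    have hloc : IsLocalMax (fun b' => -(k * (y - b') ^ 4 + θ * (a - b') ^ 2)) b :=
      Eventually.of_forall fun b' => by
        have := hmax t x s y a b' ht hs
        rw [hθ] at this
        linarith
    have hder : HasDerivAt (fun b' => -(k * (y - b') ^ 4 + θ * (a - b') ^ 2))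
        (-(-(4 * k * (y - b) ^ 3) + -(θ * (2 * (a - b))))) b := by
      have h1 : HasDerivAt (fun b' => k * (y - b') ^ 4) (-(4 * k * (y - b) ^ 3)) b := by
        have := (((hasDerivAt_id b).const_sub y).pow 4).const_mul k
        convert! this using 1
        simp
        ring
      have h2 : HasDerivAt (fun b' => θ * (a - b') ^ 2) (-(θ * (2 * (a - b)))) b := by
        have := (((hasDerivAt_id b).const_sub a).pow 2).const_mul θ
        convert! this using 1
        simp
      exact (h1.add h2).neg
    have := hloc.hasDerivAt_eq_zero hder
    rw [hd]
    linarith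
  -- Moving (x, a) by z and (y, b) by z' leaves both quartics unchanged. The choices (z, 0), (0, z)
  -- and (z, z) give the three bounds below; in the last the θ term vanishes.
  have hshift : ∀ z z', (u (t, x + z) - u (t, x)) + (w (s, y + z') - w (s, y)) ≤
      θ * ((d + z - z') ^ 2 - d ^ 2) + δ * (q * z + z ^ 2) := by
    intro z z'
    have h1 := hmax t (x + z) s (y + z') (a + z) (b + z') ht hs
    have h2 := mul_le_mul_of_nonneg_left (log_one_add_sq_add_le a z) hδ.le
    rw [hθ, show x + z - (a + z) = x - a by ring, show y + z' - (b + z') = y - b by ring,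
      show a + z - (b + z') = d + z - z' by rw [hd]; ring] at h1
    linarith
  have huz : ∀ z, |u (t, x + z) - u (t, x)| ≤ 2 * C := fun z => by
    have := (abs_sub _ _).trans (add_le_add (huC (t, x + z) (mem_Q_iff.2 ht))
      (huC (t, x) (mem_Q_iff.2 ht)))
    linarith
  have hwz : ∀ z, |w (s, y + z) - w (s, y)| ≤ 2 * C := fun z => by
    have := (abs_sub _ _).trans (add_le_add (hwC (s, y + z) (mem_Q_iff.2 hs))
      (hwC (s, y) (mem_Q_iff.2 hs)))
    linarith
  have humeas := (hu.1.measurable_slice ht x).sub_const (u (t, x))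
  have hwmeas := (hw.1.measurable_slice hs y).sub_const (w (s, y))
  set g₁ : ℝ → ℝ := fun t' => n * Real.exp (lam * t') * d ^ 2 + γ * t' + m * (t' - s) ^ 2 with hg₁
  set g₂ : ℝ → ℝ := fun s' => m * (t - s') ^ 2 with hg₂
  have hdg₁ : deriv g₁ t = lam * θ * d ^ 2 + γ + 2 * m * (t - s) := by
    have h1 : HasDerivAt (fun t' => n * Real.exp (lam * t') * d ^ 2) (lam * θ * d ^ 2) t := by
      have := ((((hasDerivAt_id t).const_mul lam).exp).const_mul n).mul_const (d ^ 2)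
      convert! this using 1
      rw [← hθ]
      simp only [id, mul_one]
      ring
    have h2 : HasDerivAt (fun t' => γ * t') γ t := by
      simpa using (hasDerivAt_id t).const_mul γ
    have h3 : HasDerivAt (fun t' => m * (t' - s) ^ 2) (2 * m * (t - s)) t := by
      have := (((hasDerivAt_id t).sub_const s).pow 2).const_mul m
      convert! this using 1
      simp
      ring
    exact ((h1.add h2).add h3).deriv
  have hdg₂ : deriv g₂ s = -(2 * m * (t - s)) := by
    have h3 : HasDerivAt (fun s' => m * (t - s') ^ 2) (-(2 * m * (t - s))) s := by
      have := (((hasDerivAt_id s).const_sub t).pow 2).const_mul m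
      convert! this using 1
      simp
      ring
    exact h3.deriv
  set e : ℝ → ℝ := fun p => k * (6 * p ^ 2 + 4 * |p| + 1) with he
  set P₁ := 2 * θ * d + δ * q with hP₁
  set P₂ := 2 * θ * d with hP₂
  -- The only r-dependent error is the inner quartic integral. Its coefficient involves `k` but is
  -- fixed as r → 0, so `k` leaves no trace in the limit.
  have key : ∀ r, 0 < r → r < 1 → r < R → r < ρ₁ → r < ρ₂ →
      lam * θ * d ^ 2 + γ - (e (x - a) * |P₁| + e (y - b) * |P₂|) * (∫ z in Ioo (-r) r, z ^ 2 * W z) ≤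
        L * |x - y| * |P₂| + |deriv U x| * (δ * |q|)
        + (δ * J + 4 * C * T) * |P₂| + ((θ + δ) * J + 2 * C * T) * δ := by
    intro r hr0 hr1 hrR hr₁ hr₂
    have H₁ := hu.deriv_le hW (g := g₁) (c := a) (x := x) (r := r) hk
      (ContDiff.contDiffOn (by fun_prop)) ht (fun t' x' ht' => by
        have := hmax t' x' s y a b ht' hs
        simp only [hg₁, hd]
        linarith) hr0 hr₁
    have H₂ := hw.deriv_le hW (g := g₂) (c := b) (x := y) (r := r) hk
      (ContDiff.contDiffOn (by fun_prop)) hs (fun s' y' hs' => by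
        have := hmax t x s' y' a b ht hs'
        simp only [hg₂]
        linarith) hr0 hr₂
    have hU' : deriv (fun x => -U x) y = -deriv U y := deriv.fun_neg
    rw [hdg₁, hP1] at H₁
    rw [hdg₂, hP2, abs_neg, hU'] at H₂
    have E₁ := hW.quartic_integral_le (p := x - a) hk.le hr1.le
    have E₂ := hW.quartic_integral_le (p := y - b) hk.le hr1.le
    set I := ∫ z in (Ioo (-r) r)ᶜ, (u (t, x + z) - u (t, x)) * W z with hI
    set I' := ∫ z in (Ioo (-r) r)ᶜ, (w (s, y + z) - w (s, y)) * W z with hI'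
    have hIB : I ≤ (θ + δ) * J + 2 * C * T := by
      rw [← hJ, ← hT]
      refine hW.integral_compl_mul_le (c := P₁) hr0 hrR.le humeas huz (by positivity)
        (fun z => ?_) (fun z => (le_abs_self _).trans (huz z))
      have := hshift z 0
      simp only [add_zero, sub_self, sub_zero] at this
      rw [hP₁]
      linarith
    have hI'B : I' ≤ (θ + δ) * J + 2 * C * T := by
      have : I' ≤ θ * J + 2 * C * T := by
        rw [← hJ, ← hT]
        refine hW.integral_compl_mul_le (c := -P₂) hr0 hrR.le hwmeas hwz hθ0.le
          (fun z => ?_) (fun z => (le_abs_self _).trans (hwz z))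
        have := hshift 0 z
        simp only [add_zero, sub_self, mul_zero] at this
        rw [hP₂]
        linarith
      nlinarith
    have hII' : I + I' ≤ δ * J + 4 * C * T := by
      rw [hI, hI', ← integral_add (hW.integrableOn_compl_mul hr0 humeas huz)
        (hW.integrableOn_compl_mul hr0 hwmeas hwz), ← hJ, ← hT]
      simp_rw [← add_mul]
      refine hW.integral_compl_mul_le (c := δ * q) (K := 2 * C + 2 * C) hr0 hrR.le
        (humeas.add hwmeas)
        (fun z => (abs_add_le _ _).trans (add_le_add (huz z) (hwz z))) hδ.le (fun z => ?_)
        (fun z => ?_)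
      · have := hshift z z
        simp only [add_sub_cancel_right, sub_self, mul_zero] at this
        linarith
      · linarith [(le_abs_self _).trans (huz z), (le_abs_self _).trans (hwz z)]
    have hPP : |P₁ - P₂| ≤ δ * |q| := by
      rw [hP₁, hP₂, add_sub_cancel_left, abs_mul, abs_of_pos hδ]
    have hq1 : |q| ≤ 1 := abs_two_mul_div_one_add_sq_le a
    have hB := mul_abs_add_mul_abs_le hIB hI'B hII' (by positivity) (by positivity)
      (hPP.trans (mul_le_of_le_one_right hδ.le hq1))
    have hU1 : deriv U x * |P₁| - deriv U y * |P₂| ≤ L * |x - y| * |P₂| + |deriv U x| * (δ * |q|) := by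
      have h1 : (deriv U x - deriv U y) * |P₂| ≤ L * |x - y| * |P₂| := by
        gcongr
        exact (le_abs_self _).trans (by simpa [Real.dist_eq] using hL.dist_le_mul x y)
      have h2 : deriv U x * (|P₁| - |P₂|) ≤ |deriv U x| * (δ * |q|) := by
        refine (le_abs_self _).trans ?_
        rw [abs_mul]
        gcongr
        exact (abs_abs_sub_abs_le_abs_sub _ _).trans hPP
      linarith
    have F₁ := mul_le_mul_of_nonneg_right E₁ (abs_nonneg P₁)
    have F₂ := mul_le_mul_of_nonneg_right E₂ (abs_nonneg P₂)
    simp only [he]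
    linarith
  have hlim := (hW.tendsto_sq_integral.const_mul
    (e (x - a) * |P₁| + e (y - b) * |P₂|)).const_sub (lam * θ * d ^ 2 + γ)
  rw [mul_zero, sub_zero] at hlim
  refine le_of_tendsto hlim ?_
  filter_upwards [Ioo_mem_nhdsGT (lt_min (lt_min one_pos hR) (lt_min hρ₁ hρ₂))] with r hr
  have h := hr.2
  simp only [lt_min_iff] at h
  exact key r hr.1 h.1.1 h.1.2 h.2.1 h.2.2

/-! ### Choice of parameters and conclusion -/

theorem exists_pos_mul_le (A : ℝ) {e : ℝ} (he : 0 < e) : ∃ z > 0, A * z ≤ e := by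
  refine ⟨e / (|A| + 1), by positivity, ?_⟩
  rw [← mul_div_assoc, div_le_iff₀ (by positivity)]
  nlinarith [le_abs_self A]

/-- The coefficients have the form 2C/c so that a penalty of at most 2C bounds the penalised power
by exactly c. -/
theorem doubling_bounds {u w : ℝ × ℝ → ℝ} {C r κ τ lam δ γ : ℝ} (huC : ∀ p ∈ Q, |u p| ≤ C)
    (hwC : ∀ p ∈ Q, |w p| ≤ C) (hC : 0 < C) (hr : 0 < r) (hκ : 0 < κ) (hτ : 0 < τ)
    (hlam : 0 ≤ lam) (hδ : 0 < δ) (hγ : 0 < γ) {t x s y a b : ℝ} (ht : 0 < t) (hs : 0 < s)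
    (h : 0 ≤ doubling u w (2 * C / r ^ 4) (2 * C / κ ^ 2) lam δ γ (2 * C / τ ^ 2) t x s y a b) :
    |x - a| ≤ r ∧ |y - b| ≤ r ∧ |a - b| ≤ κ ∧ |a| ≤ Real.exp (2 * C / δ) ∧ t ≤ 2 * C / γ ∧
      |t - s| ≤ τ := by
  obtain ⟨h1, h2, h3, h4, h5, h6⟩ := doubling_penalty_le huC hwC (by positivity) (by positivity)
    hδ hγ (by positivity) ht hs h
  have hcancel : ∀ {c z : ℝ}, 0 < c → 2 * C / c * z ≤ 2 * C → z ≤ c := fun {c z} hc hz => by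
    rw [div_mul_eq_mul_div, div_le_iff₀ hc] at hz
    exact le_of_mul_le_mul_left hz (by positivity)
  have hfour : ∀ {z : ℝ}, z ^ 4 ≤ r ^ 4 → |z| ≤ r := fun {z} hz => by
    rw [← Even.pow_abs (by decide : Even 4) z] at hz
    exact le_of_pow_le_pow_left₀ (by norm_num) hr.le hz
  refine ⟨hfour (hcancel (by positivity) h1), hfour (hcancel (by positivity) h2), ?_, ?_, ?_, ?_⟩
  · refine abs_le_of_sq_le_sq (hcancel (by positivity) (le_trans ?_ h3)) hκ.le
    gcongr
    exact le_mul_of_one_le_right (by positivity) (Real.one_le_exp (by positivity))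
  · exact abs_le_exp_of_log_le (by rwa [le_div_iff₀' hδ])
  · rwa [le_div_iff₀' hγ]
  · exact abs_le_of_sq_le_sq (hcancel (by positivity) h6) hτ.le

/-- The error terms at a maximum point of the doubled function are small. -/
theorem doubling_error_le {U : ℝ → ℝ} {L : ℝ≥0} (hL : LipschitzWith L (deriv U))
    {x y a b κ r C θ Θ J T D δ : ℝ} (hC : 0 ≤ C) (hδ : 0 < δ) (hδ1 : δ ≤ 1) (hJ0 : 0 ≤ J) (hT0 : 0 ≤ T)
    (hr : 0 ≤ r) (hr1 : r ≤ 1) (hκ : 0 ≤ κ) (hθ0 : 0 < θ) (hθΘ : θ ≤ Θ) (hD : D = 2 * Θ * κ)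
    (h1 : |x - a| ≤ r) (h2 : |y - b| ≤ r) (h3 : |a - b| ≤ κ) :
    L * |x - y| * |2 * θ * (a - b)| + |deriv U x| * (δ * |2 * a / (1 + a ^ 2)|)
      + (δ * J + 4 * C * T) * |2 * θ * (a - b)| + ((θ + δ) * J + 2 * C * T) * δ ≤
    2 * L * θ * (a - b) ^ 2 + 2 * L * D * r + 4 * C * T * D
      + (|deriv U 0| + 3 * L + J * D + ((Θ + 1) * J + 2 * C * T)) * δ := by
  set q := 2 * a / (1 + a ^ 2) with hq
  have hΘ0 : 0 < Θ := hθ0.trans_le hθΘ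
  have hD0 : 0 ≤ D := by rw [hD]; positivity
  have hq1 : |q| ≤ 1 := abs_two_mul_div_one_add_sq_le a
  have hq2 : |a| * |q| ≤ 2 := abs_mul_abs_two_mul_div_one_add_sq_le a
  have hP : |2 * θ * (a - b)| ≤ D := by
    rw [abs_mul, abs_of_pos (by positivity : 0 < 2 * θ), hD]
    gcongr
  have hxy : |x - y| ≤ |a - b| + 2 * r := by
    have := abs_add_three (x - a) (a - b) (b - y)
    rw [show x - a + (a - b) + (b - y) = x - y by ring, abs_sub_comm b y] at this
    linarith
  have hUx : |deriv U x| * (δ * |q|) ≤ (|deriv U 0| + 3 * L) * δ := by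
    have hx : |x| ≤ |a| + 1 := by
      have := abs_add_le (x - a) a
      rw [sub_add_cancel] at this
      linarith
    have hUL : |deriv U x| ≤ |deriv U 0| + L * (|a| + 1) := by
      have h := hL.dist_le_mul x 0
      rw [Real.dist_eq, Real.dist_eq, sub_zero] at h
      have h' := abs_add_le (deriv U x - deriv U 0) (deriv U 0)
      rw [sub_add_cancel] at h'
      have : (L : ℝ) * |x| ≤ L * (|a| + 1) := by gcongr
      linarith
    calc |deriv U x| * (δ * |q|) ≤ (|deriv U 0| + L * (|a| + 1)) * (δ * |q|) := by gcongr
      _ = (|deriv U 0| * |q| + L * (|a| * |q| + |q|)) * δ := by ring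
      _ ≤ (|deriv U 0| * 1 + L * (2 + 1)) * δ := by gcongr
      _ = _ := by ring
  have hLxy : L * |x - y| * |2 * θ * (a - b)| ≤ 2 * L * θ * (a - b) ^ 2 + 2 * L * D * r := by
    calc L * |x - y| * |2 * θ * (a - b)| ≤ L * (|a - b| + 2 * r) * |2 * θ * (a - b)| := by gcongr
      _ = L * |a - b| * |2 * θ * (a - b)| + 2 * L * |2 * θ * (a - b)| * r := by ring
      _ ≤ L * |a - b| * |2 * θ * (a - b)| + 2 * L * D * r := by gcongr
      _ = _ := by
        rw [abs_mul, abs_of_pos (by positivity : 0 < 2 * θ), ← sq_abs (a - b)]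
        ring
  have hI : (δ * J + 4 * C * T) * |2 * θ * (a - b)| ≤ J * D * δ + 4 * C * T * D := by
    calc (δ * J + 4 * C * T) * |2 * θ * (a - b)| ≤ (δ * J + 4 * C * T) * D := by gcongr
      _ = _ := by ring
  have hB : ((θ + δ) * J + 2 * C * T) * δ ≤ ((Θ + 1) * J + 2 * C * T) * δ := by gcongr
  linarith

set_option maxHeartbeats 400000 in
/-- Comparison for two subsolutions with opposite forcing: their sum is nonpositive if it is so
initially. -/
theorem add_nonpos_of_subsolutions {W U : ℝ → ℝ} (hW : IsLevyDensity W) {L : ℝ≥0}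
    (hL : LipschitzWith L (deriv U)) {u₀ : ℝ → ℝ} (hu₀ : UniformContinuous u₀)
    {u w : ℝ × ℝ → ℝ} (hu : IsSubsolution W U u) (hw : IsSubsolution W (fun x => -U x) w)
    (hu_init : ∀ x : ℝ, ∀ σ > 0, ∀ᶠ p in 𝓝[Q] ((0 : ℝ), x), u p < u₀ x + σ)
    (hw_init : ∀ x : ℝ, ∀ σ > 0, ∀ᶠ p in 𝓝[Q] ((0 : ℝ), x), w p < -u₀ x + σ)
    {t₀ x₀ : ℝ} (ht₀ : 0 < t₀) : u (t₀, x₀) + w (t₀, x₀) ≤ 0 := by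
  by_contra! hcontra
  obtain ⟨ρ₁, hρ₁, hu⟩ := hu
  obtain ⟨ρ₂, hρ₂, hw⟩ := hw
  obtain ⟨C, hC, huC, hwC⟩ : ∃ C > 0, (∀ p ∈ Q, |u p| ≤ C) ∧ ∀ p ∈ Q, |w p| ≤ C := by
    obtain ⟨C₁, h₁⟩ := hu.2.1
    obtain ⟨C₂, h₂⟩ := hw.2.1
    refine ⟨max 1 (max C₁ C₂), lt_max_of_lt_left one_pos, fun p hp => ?_, fun p hp => ?_⟩
    · exact (h₁ p hp).trans ((le_max_left _ _).trans (le_max_right _ _))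
    · exact (h₂ p hp).trans ((le_max_right _ _).trans (le_max_right _ _))
  -- Of the 3σ, one σ pays for γt₀, one for the logarithm at x₀, and one remains as the level of the
  -- doubled function.
  obtain ⟨σ, hσ, hσ3⟩ : ∃ σ > 0, u (t₀, x₀) + w (t₀, x₀) = 3 * σ :=
    ⟨(u (t₀, x₀) + w (t₀, x₀)) / 3, by positivity, by ring⟩
  -- the penalisation parameters, each depending on the previous ones
  obtain ⟨γ, hγ, hγt⟩ := exists_pos_mul_le t₀ hσ
  obtain ⟨κ, hκ, hκu⟩ := Metric.uniformContinuous_iff.1 hu₀ (σ / 4) (by positivity)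
  set lam : ℝ := 2 * L with hlam
  have hlam0 : 0 ≤ lam := by positivity
  set n := 2 * C / (κ / 4) ^ 2 with hn
  have hn0 : 0 < n := by positivity
  set Θ := n * Real.exp (lam * (2 * C / γ)) with hΘ
  have hΘ0 : 0 < Θ := by positivity
  set D := 2 * Θ * (κ / 4) with hD
  have hD0 : 0 < D := by positivity
  obtain ⟨r, hr, hrκ, hr1, hrD⟩ : ∃ r > 0, r ≤ κ / 4 ∧ r ≤ 1 ∧ 2 * L * D * r ≤ γ / 5 := by
    obtain ⟨r, hr, h⟩ := exists_pos_mul_le (2 * L * D) (show 0 < γ / 5 by positivity)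
    refine ⟨min r (min (κ / 4) 1), by positivity, ?_, ?_, ?_⟩
    · exact (min_le_right _ _).trans (min_le_left _ _)
    · exact (min_le_right _ _).trans (min_le_right _ _)
    · refine le_trans ?_ h
      gcongr
      exact min_le_left _ _
  set k := 2 * C / r ^ 4 with hk
  have hk0 : 0 < k := by positivity
  obtain ⟨R, hR, hRT⟩ : ∃ R > 0, 4 * C * (∫ z in (Ioo (-R) R)ᶜ, W z) * D ≤ γ / 5 := by
    have h := (hW.tendsto_tail.const_mul (4 * C)).mul_const D
    rw [mul_zero, zero_mul] at h
    obtain ⟨R, hR, hR0⟩ := ((h.eventually_le_const (show 0 < γ / 5 by positivity)).and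
      (eventually_gt_atTop 0)).exists
    exact ⟨R, hR0, hR⟩
  set J := ∫ z in Ioo (-R) R, z ^ 2 * W z with hJ
  set T := ∫ z in (Ioo (-R) R)ᶜ, W z with hT
  have hJ0 : 0 ≤ J := hW.sq_integral_nonneg _
  have hT0 : 0 ≤ T := hW.tail_nonneg _
  obtain ⟨δ, hδ, hδ1, hδγ, hδσ⟩ : ∃ δ > 0, δ ≤ 1 ∧
      (|deriv U 0| + 3 * L + J * D + ((Θ + 1) * J + 2 * C * T)) * δ ≤ γ / 5 ∧
      Real.log (1 + x₀ ^ 2) * δ ≤ σ := by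
    obtain ⟨δ₁, hδ₁, h₁⟩ := exists_pos_mul_le
      (|deriv U 0| + 3 * L + J * D + ((Θ + 1) * J + 2 * C * T)) (show 0 < γ / 5 by positivity)
    obtain ⟨δ₂, hδ₂, h₂⟩ := exists_pos_mul_le (Real.log (1 + x₀ ^ 2)) hσ
    have hlog := log_one_add_sq_nonneg x₀
    refine ⟨min 1 (min δ₁ δ₂), by positivity, min_le_left _ _, le_trans ?_ h₁, le_trans ?_ h₂⟩
    · gcongr
      exact (min_le_right _ _).trans (min_le_left _ _)
    · gcongr
      exact (min_le_right _ _).trans (min_le_right _ _)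
  -- This bounds |x| and |y|, through |a| ≤ exp(2C/δ), |a-b| ≤ κ/4 and r ≤ 1. The time layer `τ` may
  -- depend on it, since `m` is chosen last.
  set X := Real.exp (2 * C / δ) + κ / 4 + 1 with hX
  obtain ⟨τ₁, hτ₁, hτu⟩ := exists_forall_le_of_eventually_nhdsWithin hu₀.continuous hu_init X
    (show 0 < σ / 4 by positivity)
  obtain ⟨τ₂, hτ₂, hτw⟩ := exists_forall_le_of_eventually_nhdsWithin hu₀.continuous.neg hw_init X
    (show 0 < σ / 4 by positivity)
  set τ := min τ₁ τ₂ with hτ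
  have hτ0 : 0 < τ := lt_min hτ₁ hτ₂
  set m := 2 * C / (τ / 2) ^ 2 with hm
  have hm0 : 0 < m := by positivity
  have hbounds : ∀ t x s y a b, 0 < t → 0 < s → σ ≤ doubling u w k n lam δ γ m t x s y a b →
      |x - a| ≤ r ∧ |y - b| ≤ r ∧ |a - b| ≤ κ / 4 ∧ |a| ≤ Real.exp (2 * C / δ) ∧ t ≤ 2 * C / γ ∧
        |t - s| ≤ τ / 2 := fun t x s y a b ht hs h =>
    doubling_bounds huC hwC hC hr (by positivity) (half_pos hτ0) hlam0 hδ hγ ht hs (hσ.le.trans h)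
  have hpos : ∀ t x s y a b, 0 < t → 0 < s → σ ≤ doubling u w k n lam δ γ m t x s y a b →
      τ / 2 ≤ t ∧ τ / 2 ≤ s := by
    intro t x s y a b ht hs h
    obtain ⟨h1, h2, h3, h4, -, h6⟩ := hbounds t x s y a b ht hs h
    rw [abs_le] at h1 h2 h3 h4 h6
    -- If one time is below τ/2, both are below τ. As |x-y| ≤ 2r + κ/4 < κ, the initial bounds give
    -- u + w < 3σ/4, below the level σ.
    by_contra hlt
    have htτ : t < τ ∧ s < τ := by
      rw [not_and_or, not_le, not_le] at hlt
      rcases hlt with hlt | hlt <;> constructor <;> linarith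
    have hx : |x| ≤ X := abs_le.2 ⟨by linarith, by linarith⟩
    have hy : |y| ≤ X := abs_le.2 ⟨by linarith, by linarith⟩
    have hux := hτu t x ht (htτ.1.trans_le (min_le_left _ _)) hx
    have hwy := hτw s y hs (htτ.2.trans_le (min_le_right _ _)) hy
    have hxy : dist (u₀ x) (u₀ y) < σ / 4 := hκu (by
      rw [Real.dist_eq, abs_lt]
      constructor <;> linarith)
    rw [Real.dist_eq, abs_lt] at hxy
    rw [Pi.neg_apply] at hwy
    have e1 : 0 ≤ k * (x - a) ^ 4 := by positivity
    have e2 : 0 ≤ k * (y - b) ^ 4 := by positivity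
    have e3 : 0 ≤ n * Real.exp (lam * t) * (a - b) ^ 2 := by positivity
    have e4 : 0 ≤ δ * Real.log (1 + a ^ 2) := mul_nonneg hδ.le (log_one_add_sq_nonneg a)
    have e5 : 0 ≤ γ * t := by positivity
    have e6 : 0 ≤ m * (t - s) ^ 2 := by positivity
    rw [doubling] at h
    linarith
  have h₀ : σ ≤ doubling u w k n lam δ γ m t₀ x₀ t₀ x₀ x₀ x₀ := by
    simp only [doubling, sub_self]
    nlinarith
  obtain ⟨t, x, s, y, a, b, ht, hs, hge, hmax⟩ := exists_isMaxOn_doubling hu.1 hw.1 huC hwC hk0 hn0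
    hlam0 hδ hγ hm0 hσ.le (half_pos hτ0) hpos ht₀ ht₀ h₀
  obtain ⟨h1, h2, h3, -, h5, -⟩ := hbounds t x s y a b ht hs hge
  set θ := n * Real.exp (lam * t) with hθ
  have hθ0 : 0 < θ := by positivity
  have hθΘ : θ ≤ Θ := by
    rw [hθ, hΘ]
    gcongr
  have hfin := doubling_max_inequality hW hρ₁ hρ₂ hu hw hL huC hwC hk0 hn0 hδ ht hs hmax hθ.symm hR
    hJ.symm hT.symm
  have herr := doubling_error_le hL hC.le hδ hδ1 hJ0 hT0 hr.le hr1 (by positivity) hθ0 hθΘ hD h1 h2 h3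
  -- Since λ = 2L, the terms in θ(a-b)² cancel and γ ≤ 3γ/5 remains.
  linarith

theorem theorem3p10
    (V V₂ U : ℝ → ℝ) (α : ℝ) (hα : 0 < α)
    (hV_even : ∀ x : ℝ, x ≠ 0 → V (-x) = V x)
    (hV_convex : ConvexOn ℝ (Ioi 0) V)
    (hV_sobolev : IsWeakDeriv2On (Ioi 0) V V₂)
    (hV_tail : IntegrableOn V₂ (Ioi 1))
    (hV_sing : LocallyIntegrable (fun x : ℝ => x ^ 2 * V₂ |x|))
    (hU : ContDiff ℝ 1 U) (hU_lip : ∃ K : ℝ≥0, LipschitzWith K (deriv U))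
    (u₀ : ℝ → ℝ) (hu₀_unif : UniformContinuous u₀) (hu₀_bdd : ∃ C : ℝ, ∀ x : ℝ, |u₀ x| ≤ C)
    (u v : ℝ × ℝ → ℝ)
    (hu : IsSubsolution (scaledSecondDeriv V₂ α) U u)
    (hv : IsSupersolution (scaledSecondDeriv V₂ α) U v)
    (hu_init : ∀ x : ℝ, upperInitial u x ≤ u₀ x)
    (hv_init : ∀ x : ℝ, u₀ x ≤ lowerInitial v x) :
    ∀ t x : ℝ, 0 < t → u (t, x) ≤ v (t, x) := by
  intro t x ht
  obtain ⟨L, hL⟩ := hU_lip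
  have hW := isLevyDensity_scaledSecondDeriv hα hV_convex hV_sobolev hV_tail hV_sing
  obtain ⟨ρ₁, hρ₁, hu⟩ := hu
  obtain ⟨ρ₂, hρ₂, hv⟩ := hv
  have hbddu : ∀ x : ℝ, IsBoundedUnder (· ≤ ·) (𝓝[Q] ((0 : ℝ), x)) u := fun x => by
    obtain ⟨C, hC⟩ := hu.2.1
    exact ⟨C, eventually_map.2 (eventually_mem_nhdsWithin.mono fun p hp => (abs_le.1 (hC p hp)).2)⟩
  have hbddv : ∀ x : ℝ, IsBoundedUnder (· ≥ ·) (𝓝[Q] ((0 : ℝ), x)) v := fun x => by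
    obtain ⟨C, hC⟩ := hv.2.1
    exact ⟨-C, eventually_map.2 (eventually_mem_nhdsWithin.mono fun p hp => (abs_le.1 (hC p hp)).1)⟩
  have := add_nonpos_of_subsolutions hW hL hu₀_unif ⟨ρ₁, hρ₁, hu⟩ ⟨ρ₂, hρ₂, hv.neg⟩
    (fun x σ hσ => eventually_lt_of_limsup_lt
      (lt_of_le_of_lt (hu_init x) (lt_add_of_pos_right _ hσ)) (hbddu x))
    (fun x σ hσ => by
      have h : u₀ x - σ < liminf v (𝓝[Q] ((0 : ℝ), x)) :=
        lt_of_lt_of_le (sub_lt_self _ hσ) (hv_init x)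
      filter_upwards [eventually_lt_of_lt_liminf h (hbddv x)] with p hp
      linarith)
    (x₀ := x) ht
  linarith
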